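/- A finite model is a pair $\mathbb{M}=(M,S)$ with a finite universe $M$ and a binary relation $S\subseteq M\times M$. For $f:\mathbb{N}\to\mathbb{N}$, the Ramsey quantifier $\mathsf{R}_f$ is the class of all finite models $(M,S)$ for which there is a set $A\subseteq M$ with $|A|\ge f(|M|)$ such that $(a,b)\in S$ for all $a,b\in A$. The function $f$ is called polynomial-time computable if the value $f(n)$, written in binary, can be computed from $n$ given in unary by a Turing machine in time polynomial in $n$. The quantifier $\mathsf{R}_f$ is called polynomial-time computable if the problem of deciding whether a given finite model, encoded as the binary string of length $|M|^2$ that lists the rows of the adjacency matrix of $S$ with respect to some enumeration of $M$, belongs to $\mathsf{R}_f$ is in $\mathrm{P}$. Proposition. Let $c\in\mathbb{N}$ be a constant, and let $f:\mathbb{N}\to\mathbb{N}$ be any polynomial-time computable function such that, for all sufficiently large $n$, $f(n)\ge n-c\log_2 n$. Then $\mathsf{R}_f$ is polynomial-time computable. -/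

import Mathlib

open Filter

/-- A function on natural numbers is polynomial-time computable if some multi-stack Turing
machine, started on the unary notation `1ⁿ` of the argument, outputs the binary notation of
`f n` within a number of steps polynomial in `n`. -/
def PolyTimeComputable (f : ℕ → ℕ) : Prop :=
  Nonempty (Turing.TM2ComputableInPolyTime
    Computability.unaryEncodeNat Computability.encodeNat f)

open Classical in
/-- The class P: languages of binary strings whose characteristic function is computed by a
multi-stack Turing machine, total on all binary strings, within a number of steps polynomial in
the length of the string. -/
def InP (L : Language Bool) : Prop :=
  Nonempty (Turing.TM2ComputableInPolyTime
    (id : List Bool → List Bool) Computability.encodeBool (fun w => decide (w ∈ L)))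

/-- A finite relational model `(M, S)` with universe `M` and one binary relation `S`. -/
structure FiniteModel where
  /-- the universe -/
  carrier : Type
  /-- the universe is finite -/
  [fin : Fintype carrier]
  /-- the binary relation -/
  rel : carrier → carrier → Prop

attribute [instance] FiniteModel.fin

/-- `A ⊆ U` is `f`-large relative to the finite set `U`: `|A| ≥ f |U|`. -/
def IsLarge (f : ℕ → ℕ) {U : Type} [Fintype U] (A : Finset U) : Prop :=
  f (Fintype.card U) ≤ A.card

/-- The Ramsey quantifier `R_f`, as a class of finite models: there is an `f`-large set `A` such
that `S a b` for all `a, b ∈ A` (the case `a = b` included). -/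
def RamseyQuantifier (f : ℕ → ℕ) : Set FiniteModel :=
  {M | ∃ A : Finset M.carrier, IsLarge f A ∧ ∀ a ∈ A, ∀ b ∈ A, M.rel a b}

open Classical in
/-- The binary encoding of a finite model relative to an enumeration `e` of its universe: the
`n * n` bits of the adjacency matrix of the relation, row by row. -/
noncomputable def FiniteModel.encode (M : FiniteModel) {n : ℕ} (e : Fin n ≃ M.carrier) :
    List Bool :=
  (List.finRange n).flatMap fun i => (List.finRange n).map fun j => decide (M.rel (e i) (e j))

/-- The language of a class of finite models: all encodings of its members. -/
def modelLanguage (Q : Set FiniteModel) : Language Bool :=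
  {w | ∃ M ∈ Q, ∃ (n : ℕ) (e : Fin n ≃ M.carrier), w = M.encode e}

/-- A class of finite models is polynomial-time computable if its language is in P. -/
def PolyTimeQuantifier (Q : Set FiniteModel) : Prop :=
  InP (modelLanguage Q)

/-! A set `A` of at least f(n) vertices is as required exactly when its complement `C`, of size at
most k = n - f(n), contains `i` or `j` for every false matrix entry (i, j); on the diagonal this
forces a vertex without loop into `C`. So the question is vertex cover with parameter k, and a
bounded search tree answers it: at each false entry not yet covered, one bit chooses whether the row
vertex or the column vertex is deleted. One branch costs polynomial time. For large n with f(n) ≤ n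
the hypothesis gives k ≤ c log₂ n, so there are only 2^k ≤ n^c branches.

`scan` follows one branch, `exists_scan_iff` shows that some branch succeeds iff a cover of size at
most k exists, `mem_modelLanguage_iff` links this to the quantifier, and `two_pow_sub_le` bounds the
number of branches.

The rest realises the algorithm as an explicit multi-stack machine. It recovers n from the input
length n² (`sq_run`), runs the given machine for f as a subroutine (`tm_run`), subtracts f(n) from n
by repeated decrements (`dec_run`, `dec_fail`), and tries all bit strings of length k in the order
of binary counting (`search_run`). `decide_run` composes these phases and their time bounds. -/

namespace RamseyMachine

open Turing

/-! ### Stacks, registers and labels of the machine. -/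

/-- The stacks of the machine besides those of the machine computing the threshold. -/
inductive Own
  -- The stacks work in pairs, each pair acting as a tape with a head: `W`/`V` hold the matrix ahead
  -- of and behind the head, `U`/`T` the choice bits, `D`/`E` the deletion array. `N`/`M` hold n in
  -- unary, and `P`/`Q` the binary threshold.
  | W | V | N | M | U | T | D | E | P | Q
  deriving DecidableEq

instance : Fintype Own :=
  ⟨{.W, .V, .N, .M, .U, .T, .D, .E, .P, .Q}, fun x => by cases x <;> decide⟩

/-- Scratch registers: two bits and one cell of the deletion array. -/
structure Reg where
  x : Option Bool
  y : Option Bool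
  c : Option (Option Bool)
  deriving Fintype

instance : Inhabited Reg := ⟨⟨none, none, none⟩⟩

/-- Labels of the machine besides those of the machine computing the threshold. -/
inductive Lab
  | sq0 | sq1 | sq2 | copy | fetch | dec1 | dec2 | rV | moveT (b : Bool) | rD | bD | bD2
  | pass (r : Bool) | restore (r : Bool) | inc | clean (a : Bool)
  deriving Fintype

variable (tm : FinTM2)

/-- Stack alphabets. -/
@[reducible] def Γ' : tm.K ⊕ Own → Type
  | .inl k => tm.Γ k
  | .inr .W => Bool
  | .inr .V => Bool
  | .inr .N => Unit
  | .inr .M => Unit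
  | .inr .U => Bool
  | .inr .T => Bool
  | .inr .D => Option Bool
  | .inr .E => Option Bool
  | .inr .P => Bool
  | .inr .Q => Bool

/-- The contents of all stacks. -/
structure Stacks where
  g : ∀ k, List (tm.Γ k)
  W : List Bool
  V : List Bool
  N : List Unit
  M : List Unit
  U : List Bool
  T : List Bool
  D : List (Option Bool)
  E : List (Option Bool)
  P : List Bool
  Q : List Bool

variable {tm}

/-- The contents of the stacks as a function of the stack index. -/
def Stacks.toFun (s : Stacks tm) : ∀ k, List (Γ' tm k)
  | .inl k => s.g k
  | .inr .W => s.W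
  | .inr .V => s.V
  | .inr .N => s.N
  | .inr .M => s.M
  | .inr .U => s.U
  | .inr .T => s.T
  | .inr .D => s.D
  | .inr .E => s.E
  | .inr .P => s.P
  | .inr .Q => s.Q

/-- The sum of the lengths of the machine's own stacks. -/
def Stacks.size (s : Stacks tm) : ℕ :=
  s.W.length + s.V.length + s.N.length + s.M.length + s.U.length + s.T.length + s.D.length +
    s.E.length + s.P.length + s.Q.length

section update

variable (s : Stacks tm)

theorem update_g (k : tm.K) (l : List (tm.Γ k)) :
    Function.update s.toFun (.inl k) l = { s with g := Function.update s.g k l }.toFun := by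
  funext j
  rcases j with j | j
  · by_cases h : j = k
    · subst h; simp [Stacks.toFun]
    · simp [Stacks.toFun, h]
  · cases j <;> rfl

theorem update_W (l : List Bool) :
    Function.update s.toFun (.inr .W) l = { s with W := l }.toFun := by
  funext j; rcases j with j | (_ | _ | _ | _ | _ | _ | _ | _ | _ | _) <;> rfl

theorem update_V (l : List Bool) :
    Function.update s.toFun (.inr .V) l = { s with V := l }.toFun := by
  funext j; rcases j with j | (_ | _ | _ | _ | _ | _ | _ | _ | _ | _) <;> rfl

theorem update_N (l : List Unit) :
    Function.update s.toFun (.inr .N) l = { s with N := l }.toFun := by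
  funext j; rcases j with j | (_ | _ | _ | _ | _ | _ | _ | _ | _ | _) <;> rfl

theorem update_M (l : List Unit) :
    Function.update s.toFun (.inr .M) l = { s with M := l }.toFun := by
  funext j; rcases j with j | (_ | _ | _ | _ | _ | _ | _ | _ | _ | _) <;> rfl

theorem update_U (l : List Bool) :
    Function.update s.toFun (.inr .U) l = { s with U := l }.toFun := by
  funext j; rcases j with j | (_ | _ | _ | _ | _ | _ | _ | _ | _ | _) <;> rfl

theorem update_T (l : List Bool) :
    Function.update s.toFun (.inr .T) l = { s with T := l }.toFun := by
  funext j; rcases j with j | (_ | _ | _ | _ | _ | _ | _ | _ | _ | _) <;> rfl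

theorem update_D (l : List (Option Bool)) :
    Function.update s.toFun (.inr .D) l = { s with D := l }.toFun := by
  funext j; rcases j with j | (_ | _ | _ | _ | _ | _ | _ | _ | _ | _) <;> rfl

theorem update_E (l : List (Option Bool)) :
    Function.update s.toFun (.inr .E) l = { s with E := l }.toFun := by
  funext j; rcases j with j | (_ | _ | _ | _ | _ | _ | _ | _ | _ | _) <;> rfl

theorem update_P (l : List Bool) :
    Function.update s.toFun (.inr .P) l = { s with P := l }.toFun := by
  funext j; rcases j with j | (_ | _ | _ | _ | _ | _ | _ | _ | _ | _) <;> rfl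

theorem update_Q (l : List Bool) :
    Function.update s.toFun (.inr .Q) l = { s with Q := l }.toFun := by
  funext j; rcases j with j | (_ | _ | _ | _ | _ | _ | _ | _ | _ | _) <;> rfl

end update

/-! ### The program. -/

variable (tm)

/-- Statements of the machine. -/
abbrev Prog := TM2.Stmt (Γ' tm) (tm.Λ ⊕ Lab) (tm.σ × Reg)

/-- Configurations of the machine. -/
abbrev Conf := TM2.Cfg (Γ' tm) (tm.Λ ⊕ Lab) (tm.σ × Reg)

variable {tm}

open TM2.Stmt

/-- Reset the scratch registers and jump. -/
def go (l : Lab) : Prog tm :=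
  load (fun v => (v.1, default)) (goto fun _ => .inr l)

/-- The statement of the machine for the threshold, as a statement of the whole machine:
halting is replaced by a jump to `fetch`. -/
def embed : TM2.Stmt tm.Γ tm.Λ tm.σ → Prog tm
  | push k f q => push (.inl k) (fun v => f v.1) (embed q)
  | peek k f q => peek (.inl k) (fun v o => (f v.1 o, v.2)) (embed q)
  | pop k f q => pop (.inl k) (fun v o => (f v.1 o, v.2)) (embed q)
  | load a q => load (fun v => (a v.1, v.2)) (embed q)
  | branch p q₁ q₂ => branch (fun v => p v.1) (embed q₁) (embed q₂)
  | goto l => goto fun v => .inl (l v.1)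
  | halt => goto fun _ => .inr .fetch

/-- Store a popped symbol in the register `x`, as the bit given by `f`. -/
def readX {α : Type} (f : α → Bool) (v : tm.σ × Reg) (o : Option α) : tm.σ × Reg :=
  (v.1, { v.2 with x := o.map f })

/-- Store a popped symbol in the register `y`, as the bit given by `f`. -/
def readY {α : Type} (f : α → Bool) (v : tm.σ × Reg) (o : Option α) : tm.σ × Reg :=
  (v.1, { v.2 with y := o.map f })

/-- Store a popped cell in the register `c`. -/
def readC (v : tm.σ × Reg) (o : Option (Option Bool)) : tm.σ × Reg :=
  (v.1, { v.2 with c := o })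

/-- Record in the register `x` whether something was popped, unless it is already set. -/
def flag {α : Type} (v : tm.σ × Reg) (o : Option α) : tm.σ × Reg :=
  (v.1, { v.2 with x := if o.isSome then some true else v.2.x })

/-- The bit in the register `x`. -/
def xv (v : tm.σ × Reg) : Bool := v.2.x.getD false

/-- The bit in the register `y`. -/
def yv (v : tm.σ × Reg) : Bool := v.2.y.getD false

/-- The cell in the register `c`. -/
def cv (v : tm.σ × Reg) : Option Bool := v.2.c.getD none

/-- Whether the register `x` is empty. -/
def xNone (v : tm.σ × Reg) : Bool := v.2.x.isNone

/-- Whether the register `y` is empty. -/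
def yNone (v : tm.σ × Reg) : Bool := v.2.y.isNone

/-- Whether the register `c` is empty. -/
def cNone (v : tm.σ × Reg) : Bool := v.2.c.isNone

variable (eIn : tm.Γ tm.k₀ ≃ Bool) (eOut : tm.Γ tm.k₁ ≃ Bool)

/-- The program of the machine at its own labels. -/
def prog : Lab → Prog tm
  -- Square root by (m + 1)² = m² + 2m + 1: a round reads 1, m and m symbols, with m in unary on
  -- `N`. Input that ends inside a round has non-square length.
  | .sq0 => pop (.inr .W) (readX id) <| branch xNone (go .copy) <|
      push (.inr .V) xv <| go .sq1
  | .sq1 => pop (.inr .N) (readY fun _ => true) <| branch yNone (go .sq2) <|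
      push (.inr .M) (fun _ => ()) <| pop (.inr .W) (readX id) <|
      branch xNone (go (.clean false)) <| push (.inr .V) xv <| go .sq1
  | .sq2 => pop (.inr .M) (readY fun _ => true) <|
      branch yNone (push (.inr .N) (fun _ => ()) <| go .sq0) <|
      push (.inr .N) (fun _ => ()) <| pop (.inr .W) (readX id) <|
      branch xNone (go (.clean false)) <| push (.inr .V) xv <| go .sq2
  | .copy => pop (.inr .N) (readX fun _ => true) <|
      branch xNone (load (fun v => (v.1, default)) <| goto fun _ => .inl tm.main) <|
      push (.inl tm.k₀) (fun _ => eIn.symm true) <| push (.inr .M) (fun _ => ()) <|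
      push (.inr .U) (fun _ => false) <| go .copy
  | .fetch => pop (.inl tm.k₁) (readX eOut) <| branch xNone (go .dec2) <|
      push (.inr .P) xv <| go .fetch
  | .dec2 => pop (.inr .P) (readX id) <| branch xNone (go .dec1) <|
      push (.inr .Q) xv <| go .dec2
  -- Decrement of the little-endian numeral on `Q`: leading zeros become ones, the first one becomes
  -- zero. Each decrement removes a bit from `U`, so n - f(n) bits remain; if `U` is exhausted, f(n)
  -- > n.
  | .dec1 => pop (.inr .Q) (readX id) <| branch xNone (go .rV) <|
      branch xv
        (pop (.inr .U) (readY id) <| branch yNone (go (.clean false)) <|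
          push (.inr .P) (fun _ => false) <| go .dec2)
        (push (.inr .P) (fun _ => true) <| go .dec1)
  | .rV => pop (.inr .V) (readX id) <| branch xNone (go (.moveT false)) <|
      push (.inr .W) xv <| go .rV
  | .moveT b => pop (.inr .T) (readX id) <|
      branch xNone (if b then go .inc else go .rD) <| push (.inr .U) xv <| go (.moveT b)
  | .rD => pop (.inr .D) flag <| pop (.inr .E) flag <| branch xNone (go .bD) (go .rD)
  | .bD => pop (.inr .M) (readX fun _ => true) <| branch xNone (go .bD2) <|
      push (.inr .N) (fun _ => ()) <| push (.inr .D) (fun _ => some false) <| go .bD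
  -- The cell of the current row, at first row 0, holds the marker `none`; the deletion status of
  -- that row is kept in the label argument `r` instead.
  | .bD2 => pop (.inr .N) (readX fun _ => true) <|
      branch xNone (pop (.inr .D) (fun v _ => v) <| push (.inr .D) (fun _ => none) <|
        go (.pass false)) <|
      push (.inr .M) (fun _ => ()) <| go .bD2
  | .pass r => pop (.inr .W) (readX id) <| branch xNone (go (.clean true)) <|
      pop (.inr .D) readC <|
      branch cNone (push (.inr .W) xv <| go (.restore r)) <|
      push (.inr .V) xv <|
      -- This detects an uncovered false entry. On the diagonal the cell read is the marker, and
      -- then either bit deletes the row vertex.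
      branch (fun v => !xv v && !r && !decide (cv v = some true))
        (pop (.inr .U) (readY id) <| branch yNone (go (.moveT true)) <|
          push (.inr .T) yv <|
          branch (fun v => yv v || (cv v).isNone)
            (push (.inr .E) cv <| go (.pass true))
            (push (.inr .E) (fun _ => some true) <| go (.pass r)))
        (push (.inr .E) cv <| go (.pass r))
  -- The array is rewound from right to left, so when the marker appears the cell of the next row is
  -- on top of `D`. Its bit goes into the label, the marker takes its place, and `r` is stored in
  -- the cell of the old row.
  | .restore r => pop (.inr .E) readC <| branch cNone (go (.pass r)) <|
      branch (fun v => (cv v).isNone)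
        (pop (.inr .D) readC <| push (.inr .D) (fun _ => none) <|
          push (.inr .D) (fun _ => some r) <|
          branch (fun v => (cv v).getD false) (go (.restore true)) (go (.restore false)))
        (push (.inr .D) cv <| go (.restore r))
  | .inc => pop (.inr .U) (readX id) <| branch xNone (go (.clean false)) <|
      branch xv (push (.inr .T) (fun _ => false) <| go .inc)
        (push (.inr .T) (fun _ => true) <| go .rV)
  -- A final configuration must have all stacks empty except the output. All own stacks are popped
  -- in parallel, and `flag` remembers whether any of them was nonempty.
  | .clean a =>
      pop (.inr .W) flag <| pop (.inr .V) flag <| pop (.inr .N) flag <| pop (.inr .M) flag <|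
      pop (.inr .U) flag <| pop (.inr .T) flag <| pop (.inr .D) flag <| pop (.inr .E) flag <|
      pop (.inr .P) flag <| pop (.inr .Q) flag <|
      branch xNone (push (.inr .W) (fun _ => a) <| load (fun v => (v.1, default)) halt)
        (go (.clean a))

/-- The program of the whole machine. -/
def program : tm.Λ ⊕ Lab → Prog tm
  | .inl l => embed (tm.m l)
  | .inr l => prog eIn eOut l

/-- The machine deciding the Ramsey quantifier. -/
def machine : FinTM2 where
  K := tm.K ⊕ Own
  k₀ := .inr .W
  k₁ := .inr .W
  Γ := Γ' tm
  Λ := tm.Λ ⊕ Lab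
  main := .inr .sq0
  ΛFin := haveI := tm.ΛFin; inferInstance
  kFin := haveI := tm.kFin; inferInstance
  σ := tm.σ × Reg
  initialState := (tm.initialState, default)
  σFin := haveI := tm.σFin; inferInstance
  Γk₀Fin := inferInstanceAs (Fintype Bool)
  m := program eIn eOut

/-! ### Timed runs, and the behaviour of each label. -/

/-- `c'` is reached from `c` within `t` steps. -/
def Runs (c c' : Conf tm) (t : ℕ) : Prop :=
  ∃ s ≤ t, (flip Bind.bind (TM2.step (program eIn eOut)))^[s] (some c) = some c'

variable {eIn eOut}

theorem Runs.refl (c : Conf tm) : Runs eIn eOut c c 0 := ⟨0, le_rfl, rfl⟩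

theorem Runs.trans {c c' c'' : Conf tm} {t t' : ℕ} (h : Runs eIn eOut c c' t)
    (h' : Runs eIn eOut c' c'' t') : Runs eIn eOut c c'' (t + t') := by
  obtain ⟨s, hs, e⟩ := h
  obtain ⟨s', hs', e'⟩ := h'
  exact ⟨s' + s, by omega, by rw [Function.iterate_add_apply, e, e']⟩

theorem Runs.mono {c c' : Conf tm} {t t' : ℕ} (h : Runs eIn eOut c c' t) (ht : t ≤ t') :
    Runs eIn eOut c c' t' := by
  obtain ⟨s, hs, e⟩ := h
  exact ⟨s, hs.trans ht, e⟩

/-- The configuration at label `l` with stacks `s` and cleared registers. -/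
def cfg (l : Lab) (s : Stacks tm) : Conf tm :=
  ⟨some (.inr l), (tm.initialState, default), s.toFun⟩

theorem Runs.step {l l' : Lab} {s s' : Stacks tm}
    (h : TM2.stepAux (prog eIn eOut l) (tm.initialState, default) s.toFun = cfg l' s') :
    Runs eIn eOut (cfg l s) (cfg l' s') 1 :=
  ⟨1, le_rfl, congrArg some h⟩

section steps

variable {tm : FinTM2} {eIn : tm.Γ tm.k₀ ≃ Bool} {eOut : tm.Γ tm.k₁ ≃ Bool}
  {g : ∀ k, List (tm.Γ k)} {W V U T P Q : List Bool} {N M : List Unit} {D E : List (Option Bool)}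

theorem Runs.head {l l' : Lab} {s s' : Stacks tm} {c : Conf tm} {t t' : ℕ}
    (h : TM2.stepAux (prog eIn eOut l) (tm.initialState, default) s.toFun = cfg l' s')
    (h' : Runs eIn eOut (cfg l' s') c t) (ht : t + 1 ≤ t') : Runs eIn eOut (cfg l s) c t' :=
  ((Runs.step h).trans h').mono (by omega)

theorem Runs.congr {c c' c'' : Conf tm} {t : ℕ} (h : Runs eIn eOut c c' t) (e : c' = c'') :
    Runs eIn eOut c c'' t := e ▸ h

@[simp] theorem xNone_flag {α : Type} (v : tm.σ × Reg) (o : Option α) :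
    xNone (flag v o) = (o.isNone && xNone v) := by
  cases o <;> simp [xNone, flag]

@[simp] theorem flag_fst {α : Type} (v : tm.σ × Reg) (o : Option α) : (flag v o).1 = v.1 := rfl

@[simp] theorem xNone_default (a : tm.σ) : xNone (tm := tm) (a, default) = true := rfl

theorem unit_list_ext {l l' : List Unit} (h : l.length = l'.length) : l = l' :=
  List.ext_getElem h fun _ _ _ => rfl

attribute [local simp] update_g update_W update_V update_N update_M update_U update_T update_D
  update_E update_P update_Q prog program go xv yv cv xNone yNone cNone readX readY readC cfg
  Stacks.toFun

theorem sq0_nil :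
    Runs eIn eOut (cfg .sq0 ⟨g, [], V, N, M, U, T, D, E, P, Q⟩)
      (cfg .copy ⟨g, [], V, N, M, U, T, D, E, P, Q⟩) 1 :=
  .step (by simp)

theorem sq0_cons (b : Bool) :
    Runs eIn eOut (cfg .sq0 ⟨g, b :: W, V, N, M, U, T, D, E, P, Q⟩)
      (cfg .sq1 ⟨g, W, b :: V, N, M, U, T, D, E, P, Q⟩) 1 :=
  .step (by simp)

theorem sq1_run (l : List Bool) (h : N.length = l.length) :
    Runs eIn eOut (cfg .sq1 ⟨g, l ++ W, V, N, M, U, T, D, E, P, Q⟩)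
      (cfg .sq2 ⟨g, W, l.reverse ++ V, [], N ++ M, U, T, D, E, P, Q⟩) (l.length + 1) := by
  induction l generalizing V N M with
  | nil => obtain rfl := List.length_eq_zero_iff.1 h; exact .step (by simp)
  | cons b l ih =>
    obtain _ | ⟨u, N⟩ := N
    · simp at h
    have := ih (N := N) (V := b :: V) (M := () :: M) (by simpa using h)
    rw [show N ++ () :: M = u :: N ++ M from unit_list_ext (by simp; omega)] at this
    exact .head (by simp) (.congr this (by simp))
      (by simp)

theorem sq1_fail (h : W.length < N.length) :
    ∃ s' : Stacks tm, Runs eIn eOut (cfg .sq1 ⟨g, W, V, N, M, U, T, D, E, P, Q⟩)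
      (cfg (.clean false) s') (W.length + 1) ∧ s'.g = g ∧
      s'.size ≤ (⟨g, W, V, N, M, U, T, D, E, P, Q⟩ : Stacks tm).size := by
  obtain _ | ⟨u, N⟩ := N
  · simp at h
  induction W generalizing V N M u with
  | nil =>
    exact ⟨⟨g, [], V, N, () :: M, U, T, D, E, P, Q⟩, .step (by simp), rfl, by
      simp [Stacks.size]; omega⟩
  | cons b l ih =>
    obtain _ | ⟨u', N⟩ := N
    · simp at h
    obtain ⟨s', h, hg, hs⟩ := ih (V := b :: V) (M := () :: M) u' N (by simpa using h)
    exact ⟨s', .head (by simp) h le_rfl, hg, hs.trans (by simp [Stacks.size]; omega)⟩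

theorem sq2_run (l : List Bool) (h : M.length = l.length) :
    Runs eIn eOut (cfg .sq2 ⟨g, l ++ W, V, N, M, U, T, D, E, P, Q⟩)
      (cfg .sq0 ⟨g, W, l.reverse ++ V, () :: M ++ N, [], U, T, D, E, P, Q⟩) (l.length + 1) := by
  induction l generalizing V N M with
  | nil => obtain rfl := List.length_eq_zero_iff.1 h; exact .step (by simp)
  | cons b l ih =>
    obtain _ | ⟨u, M⟩ := M
    · simp at h
    have := ih (M := M) (V := b :: V) (N := () :: N) (by simpa using h)
    rw [show () :: M ++ () :: N = () :: u :: M ++ N from unit_list_ext (by simp; omega)] at this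
    exact .head (by simp) (.congr this (by simp))
      (by simp)

theorem sq2_fail (h : W.length < M.length) :
    ∃ s' : Stacks tm, Runs eIn eOut (cfg .sq2 ⟨g, W, V, N, M, U, T, D, E, P, Q⟩)
      (cfg (.clean false) s') (W.length + 1) ∧ s'.g = g ∧
      s'.size ≤ (⟨g, W, V, N, M, U, T, D, E, P, Q⟩ : Stacks tm).size := by
  obtain _ | ⟨u, M⟩ := M
  · simp at h
  induction W generalizing V N M u with
  | nil =>
    exact ⟨⟨g, [], V, () :: N, M, U, T, D, E, P, Q⟩, .step (by simp), rfl, by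
      simp [Stacks.size]; omega⟩
  | cons b l ih =>
    obtain _ | ⟨u', M⟩ := M
    · simp at h
    obtain ⟨s', h, hg, hs⟩ := ih (V := b :: V) (N := () :: N) u' M (by simpa using h)
    exact ⟨s', .head (by simp) h le_rfl, hg, hs.trans (by simp [Stacks.size]; omega)⟩

variable (tm) in
/-- All stacks of `tm` are empty except `k`, which contains `l`. -/
abbrev single (k : tm.K) (l : List (tm.Γ k)) : ∀ k, List (tm.Γ k) :=
  Function.update (fun _ => []) k l

theorem copy_run (l : List (tm.Γ tm.k₀)) :
    Runs eIn eOut (cfg .copy ⟨single tm tm.k₀ l, W, V, N, M, U, T, D, E, P, Q⟩)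
      ⟨some (.inl tm.main), (tm.initialState, default),
        (⟨single tm tm.k₀ (List.replicate N.length (eIn.symm true) ++ l), W, V, [], N ++ M,
        List.replicate N.length false ++ U, T, D, E, P, Q⟩ : Stacks tm).toFun⟩
      (N.length + 1) := by
  induction N generalizing l M U with
  | nil => exact ⟨1, le_rfl, congrArg some (by simp)⟩
  | cons u N ih =>
    refine .head (l' := .copy) (s' := ⟨single tm tm.k₀ (eIn.symm true :: l), W, V, N, () :: M,
      false :: U, T, D, E, P, Q⟩) (by simp) ?_ le_rfl
    refine (ih (eIn.symm true :: l)).congr ?_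
    rw [List.length_cons, List.replicate_succ', List.replicate_succ', List.append_assoc,
      List.append_assoc, show u :: N ++ M = N ++ () :: M from unit_list_ext (by simp; omega)]
    rfl

theorem fetch_run (l : List (tm.Γ tm.k₁)) :
    Runs eIn eOut (cfg .fetch ⟨single tm tm.k₁ l, W, V, N, M, U, T, D, E, P, Q⟩)
      (cfg .dec2 ⟨fun _ => [], W, V, N, M, U, T, D, E, (l.map eOut).reverse ++ P, Q⟩)
      (l.length + 1) := by
  induction l generalizing P with
  | nil => exact .step (by simp)
  | cons b l ih =>
    exact .head (l' := .fetch) (s' := ⟨single tm tm.k₁ l, W, V, N, M, U, T, D, E, eOut b :: P, Q⟩)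
      (by simp) (by simpa using ih (P := eOut b :: P)) le_rfl

theorem dec2_run :
    Runs eIn eOut (cfg .dec2 ⟨g, W, V, N, M, U, T, D, E, P, Q⟩)
      (cfg .dec1 ⟨g, W, V, N, M, U, T, D, E, [], P.reverse ++ Q⟩) (P.length + 1) := by
  induction P generalizing Q with
  | nil => exact .step (by simp)
  | cons b l ih =>
    exact .head (by simp) (.congr (ih (Q := b :: Q)) (by simp))
      le_rfl

theorem dec1_zero (z : ℕ) :
    Runs eIn eOut (cfg .dec1 ⟨g, W, V, N, M, U, T, D, E, P, List.replicate z false⟩)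
      (cfg .rV ⟨g, W, V, N, M, U, T, D, E, List.replicate z true ++ P, []⟩) (z + 1) := by
  induction z generalizing P with
  | zero => exact .step (by simp)
  | succ z ih =>
    exact .head (by simp [List.replicate_succ])
      (.congr (ih (P := true :: P)) (by simp [List.replicate_succ'])) le_rfl

theorem dec1_succ (z : ℕ) (b : Bool) :
    Runs eIn eOut
      (cfg .dec1 ⟨g, W, V, N, M, b :: U, T, D, E, P, List.replicate z false ++ true :: Q⟩)
      (cfg .dec2 ⟨g, W, V, N, M, U, T, D, E, false :: List.replicate z true ++ P, Q⟩) (z + 1) := by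
  induction z generalizing P with
  | zero => exact .step (by simp)
  | succ z ih =>
    exact .head (by simp [List.replicate_succ])
      (.congr (ih (P := true :: P)) (by simp [List.replicate_succ'])) le_rfl

theorem dec1_fail (z : ℕ) :
    Runs eIn eOut
      (cfg .dec1 ⟨g, W, V, N, M, [], T, D, E, P, List.replicate z false ++ true :: Q⟩)
      (cfg (.clean false) ⟨g, W, V, N, M, [], T, D, E, List.replicate z true ++ P, Q⟩)
      (z + 1) := by
  induction z generalizing P with
  | zero => exact .step (by simp)
  | succ z ih =>
    exact .head (by simp [List.replicate_succ])
      (.congr (ih (P := true :: P)) (by simp [List.replicate_succ'])) le_rfl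

theorem rV_run :
    Runs eIn eOut (cfg .rV ⟨g, W, V, N, M, U, T, D, E, P, Q⟩)
      (cfg (.moveT false) ⟨g, V.reverse ++ W, [], N, M, U, T, D, E, P, Q⟩) (V.length + 1) := by
  induction V generalizing W with
  | nil => exact .step (by simp)
  | cons b l ih =>
    exact .head (by simp) (.congr (ih (W := b :: W)) (by simp))
      le_rfl

theorem moveT_run (b : Bool) :
    Runs eIn eOut (cfg (.moveT b) ⟨g, W, V, N, M, U, T, D, E, P, Q⟩)
      (cfg (if b then .inc else .rD) ⟨g, W, V, N, M, T.reverse ++ U, [], D, E, P, Q⟩)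
      (T.length + 1) := by
  induction T generalizing U with
  | nil => cases b <;> exact .step (by simp)
  | cons b l ih =>
    exact .head (by simp) (.congr (ih (U := b :: U)) (by simp))
      le_rfl

theorem rD_run :
    Runs eIn eOut (cfg .rD ⟨g, W, V, N, M, U, T, D, E, P, Q⟩)
      (cfg .bD ⟨g, W, V, N, M, U, T, [], [], P, Q⟩) (D.length + E.length + 1) := by
  induction D generalizing E with
  | nil =>
    induction E with
    | nil => exact .step (by simp [-xNone])
    | cons b l ih => exact .head (by simp [-xNone]) ih (by simp [-xNone])
  | cons b l ih => exact .head (by simp [-xNone]) (ih (E := E.tail)) (by simp; omega)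

theorem bD_run :
    Runs eIn eOut (cfg .bD ⟨g, W, V, N, M, U, T, D, E, P, Q⟩)
      (cfg .bD2 ⟨g, W, V, M ++ N, [], U, T, List.replicate M.length (some false) ++ D, E, P, Q⟩)
      (M.length + 1) := by
  induction M generalizing N D with
  | nil => exact .step (by simp)
  | cons u M ih =>
    have := ih (N := () :: N) (D := some false :: D)
    rw [show M ++ () :: N = u :: M ++ N from unit_list_ext (by simp; omega)] at this
    exact .head (by simp) (.congr this (by simp [List.replicate_succ']))
      le_rfl

theorem bD2_run :
    Runs eIn eOut (cfg .bD2 ⟨g, W, V, N, M, U, T, D, E, P, Q⟩)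
      (cfg (.pass false) ⟨g, W, V, [], N ++ M, U, T, none :: D.tail, E, P, Q⟩)
      (N.length + 1) := by
  induction N generalizing M with
  | nil => exact .step (by simp)
  | cons u N ih =>
    have := ih (M := () :: M)
    rw [show N ++ () :: M = u :: N ++ M from unit_list_ext (by simp; omega)] at this
    exact .head (by simp) (.congr this (by simp))
      le_rfl

theorem inc_succ (z : ℕ) :
    Runs eIn eOut
      (cfg .inc ⟨g, W, V, N, M, List.replicate z true ++ false :: U, T, D, E, P, Q⟩)
      (cfg .rV ⟨g, W, V, N, M, U, true :: List.replicate z false ++ T, D, E, P, Q⟩) (z + 1) := by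
  induction z generalizing T with
  | zero => exact .step (by simp)
  | succ z ih =>
    exact .head (by simp [List.replicate_succ])
      (.congr (ih (T := false :: T)) (by simp [List.replicate_succ'])) le_rfl

theorem inc_fail (z : ℕ) :
    Runs eIn eOut
      (cfg .inc ⟨g, W, V, N, M, List.replicate z true, T, D, E, P, Q⟩)
      (cfg (.clean false) ⟨g, W, V, N, M, [], List.replicate z false ++ T, D, E, P, Q⟩)
      (z + 1) := by
  induction z generalizing T with
  | zero => exact .step (by simp)
  | succ z ih =>
    exact .head (by simp [List.replicate_succ])
      (.congr (ih (T := false :: T)) (by simp [List.replicate_succ'])) le_rfl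

theorem clean_run_of_le (a : Bool) (m : ℕ) (hW : W.length ≤ m) (hV : V.length ≤ m)
    (hN : N.length ≤ m) (hM : M.length ≤ m) (hU : U.length ≤ m) (hT : T.length ≤ m)
    (hD : D.length ≤ m) (hE : E.length ≤ m) (hP : P.length ≤ m) (hQ : Q.length ≤ m) :
    Runs eIn eOut (cfg (.clean a) ⟨g, W, V, N, M, U, T, D, E, P, Q⟩)
      ⟨none, (tm.initialState, default),
        (⟨g, [a], [], [], [], [], [], [], [], [], []⟩ : Stacks tm).toFun⟩ (m + 1) := by
  induction m generalizing W V N M U T D E P Q with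
  | zero =>
    simp only [Nat.le_zero, List.length_eq_zero_iff] at *
    subst hW hV hN hM hU hT hD hE hP hQ
    exact ⟨1, by simp, congrArg some (by simp [-xNone])⟩
  | succ m ih =>
    by_cases h : W = [] ∧ V = [] ∧ N = [] ∧ M = [] ∧ U = [] ∧ T = [] ∧ D = [] ∧ E = [] ∧ P = [] ∧
        Q = []
    · obtain ⟨rfl, rfl, rfl, rfl, rfl, rfl, rfl, rfl, rfl, rfl⟩ := h
      exact ⟨1, by simp, congrArg some (by simp [-xNone])⟩
    · have key {α : Type} {l : List α} (hl : l.length ≤ m + 1) : l.tail.length ≤ m := by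
        simp; omega
      refine .head (l' := .clean a) (s' := ⟨g, W.tail, V.tail, N.tail, M.tail, U.tail, T.tail,
        D.tail, E.tail, P.tail, Q.tail⟩) ?_ (ih (key hW) (key hV) (key hN) (key hM) (key hU)
        (key hT) (key hD) (key hE) (key hP) (key hQ)) le_rfl
      simp [-xNone]
      rw [cond_eq_ite, if_neg]
      intro hb
      simp at hb
      tauto

theorem clean_run (a : Bool) (s : Stacks tm) :
    Runs eIn eOut (cfg (.clean a) s)
      ⟨none, (tm.initialState, default),
        (⟨s.g, [a], [], [], [], [], [], [], [], [], []⟩ : Stacks tm).toFun⟩ (s.size + 1) := by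
  apply clean_run_of_le <;> unfold Stacks.size <;> omega

theorem pass_nil (r : Bool) :
    Runs eIn eOut (cfg (.pass r) ⟨g, [], V, N, M, U, T, D, E, P, Q⟩)
      (cfg (.clean true) ⟨g, [], V, N, M, U, T, D, E, P, Q⟩) 1 :=
  .step (by simp)

theorem pass_row_end (r b : Bool) :
    Runs eIn eOut (cfg (.pass r) ⟨g, b :: W, V, N, M, U, T, [], E, P, Q⟩)
      (cfg (.restore r) ⟨g, b :: W, V, N, M, U, T, [], E, P, Q⟩) 1 :=
  .step (by simp)

theorem pass_skip (r b : Bool) (c : Option Bool) (h : b = true ∨ r = true ∨ c = some true) :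
    Runs eIn eOut (cfg (.pass r) ⟨g, b :: W, V, N, M, U, T, c :: D, E, P, Q⟩)
      (cfg (.pass r) ⟨g, W, b :: V, N, M, U, T, D, c :: E, P, Q⟩) 1 :=
  .step (by rcases h with rfl | rfl | rfl <;> simp)

theorem pass_fail (c : Option Bool) (h : c ≠ some true) :
    Runs eIn eOut (cfg (.pass false) ⟨g, false :: W, V, N, M, [], T, c :: D, E, P, Q⟩)
      (cfg (.moveT true) ⟨g, W, false :: V, N, M, [], T, D, E, P, Q⟩) 1 :=
  .step (by simp [h])

theorem pass_row (c : Option Bool) (y : Bool) (h : c ≠ some true) (hy : y = true ∨ c = none) :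
    Runs eIn eOut (cfg (.pass false) ⟨g, false :: W, V, N, M, y :: U, T, c :: D, E, P, Q⟩)
      (cfg (.pass true) ⟨g, W, false :: V, N, M, U, y :: T, D, c :: E, P, Q⟩) 1 :=
  .step (by rcases hy with rfl | rfl <;> simp [h])

theorem pass_col :
    Runs eIn eOut (cfg (.pass false) ⟨g, false :: W, V, N, M, false :: U, T, some false :: D, E,
        P, Q⟩)
      (cfg (.pass false) ⟨g, W, false :: V, N, M, U, false :: T, D, some true :: E, P, Q⟩) 1 :=
  .step (by simp)

theorem restore_nil (r : Bool) :
    Runs eIn eOut (cfg (.restore r) ⟨g, W, V, N, M, U, T, D, [], P, Q⟩)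
      (cfg (.pass r) ⟨g, W, V, N, M, U, T, D, [], P, Q⟩) 1 :=
  .step (by simp)

theorem restore_mark (r d : Bool) :
    Runs eIn eOut (cfg (.restore r) ⟨g, W, V, N, M, U, T, some d :: D, none :: E, P, Q⟩)
      (cfg (.restore d) ⟨g, W, V, N, M, U, T, some r :: none :: D, E, P, Q⟩) 1 :=
  .step (by cases d <;> simp)

theorem restore_some (r : Bool) (l : List Bool) :
    Runs eIn eOut (cfg (.restore r) ⟨g, W, V, N, M, U, T, D, l.map some ++ E, P, Q⟩)
      (cfg (.restore r) ⟨g, W, V, N, M, U, T, (l.map some).reverse ++ D, E, P, Q⟩) l.length := by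
  induction l generalizing D with
  | nil => exact .refl _
  | cons b l ih =>
    exact .head (by simp) (.congr (ih (D := some b :: D)) (by simp))
      le_rfl

end steps

/-! ### Simulation of the threshold machine and the length of its output. -/

theorem iterate_bind_none {α : Type} (f : α → Option α) (t : ℕ) :
    (flip Bind.bind f)^[t] none = none := by
  induction t with
  | zero => rfl
  | succ t ih => exact ih

section embed

variable {tm : FinTM2} {eIn : tm.Γ tm.k₀ ≃ Bool} {eOut : tm.Γ tm.k₁ ≃ Bool}

/-- A configuration of `tm` as a configuration of the whole machine. -/
def lift (s : Stacks tm) (c : TM2.Cfg tm.Γ tm.Λ tm.σ) : Conf tm :=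
  ⟨some (c.l.elim (.inr .fetch) .inl), (c.var, default), { s with g := c.stk }.toFun⟩

theorem stepAux_embed (q : TM2.Stmt tm.Γ tm.Λ tm.σ) (v : tm.σ) (s : Stacks tm) :
    TM2.stepAux (embed q) (v, default) s.toFun = lift s (TM2.stepAux q v s.g) := by
  induction q generalizing v s with
  | push k f q ih => simp [embed, ih, update_g, Stacks.toFun, lift]
  | peek k f q ih => simp [embed, ih, Stacks.toFun]
  | pop k f q ih => simp [embed, ih, update_g, Stacks.toFun, lift]
  | load a q ih => simp [embed, ih]
  | branch p q₁ q₂ ih₁ ih₂ => cases h : p v <;> simp [embed, ih₁, ih₂, h]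
  | goto l => simp [embed, lift]
  | halt => simp [embed, lift]

/-- Only the last configuration of the run can be halting, so the jump to `fetch` that replaces
halting does not affect the simulated steps. -/
theorem iterate_lift (s : Stacks tm) (c c' : TM2.Cfg tm.Γ tm.Λ tm.σ) (t : ℕ)
    (h : (flip Bind.bind tm.step)^[t] (some c) = some c') :
    (flip Bind.bind (TM2.step (program eIn eOut)))^[t] (some (lift s c)) = some (lift s c') := by
  induction t generalizing c with
  | zero => exact congrArg (Option.map (lift s)) h
  | succ t ih =>
    obtain ⟨l, v, S⟩ := c
    rw [Function.iterate_succ_apply] at h ⊢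
    cases l with
    | none => exact absurd (h.symm.trans (iterate_bind_none _ t)) (by simp)
    | some l =>
      refine Eq.trans (congrArg _ ?_) (ih _ h)
      exact congrArg some (stepAux_embed (tm.m l) v { s with g := S })

theorem initList_stk (l : List (tm.Γ tm.k₀)) : (initList tm l).stk = single tm tm.k₀ l := by
  funext k
  by_cases h : k = tm.k₀
  · subst h; simp [initList]
  · simp [initList, h]

theorem haltList_stk (l : List (tm.Γ tm.k₁)) : (haltList tm l).stk = single tm tm.k₁ l := by
  funext k
  by_cases h : k = tm.k₁
  · subst h; simp [haltList]
  · simp [haltList, h]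

theorem tm_run {i : List (tm.Γ tm.k₀)} {o : List (tm.Γ tm.k₁)} {t : ℕ}
    (h : TM2OutputsInTime tm i (some o) t) {W V U T P Q : List Bool} {N M : List Unit}
    {D E : List (Option Bool)} :
    Runs eIn eOut ⟨some (.inl tm.main), (tm.initialState, default),
        (⟨single tm tm.k₀ i, W, V, N, M, U, T, D, E, P, Q⟩ : Stacks tm).toFun⟩
      (cfg .fetch ⟨single tm tm.k₁ o, W, V, N, M, U, T, D, E, P, Q⟩) t := by
  refine ⟨h.steps, h.steps_le_m, ?_⟩
  have := iterate_lift (eIn := eIn) (eOut := eOut) ⟨single tm tm.k₁ o, W, V, N, M, U, T, D, E, P, Q⟩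
    (initList tm i) (haltList tm o) h.steps h.evals_in_steps
  simp only [lift, initList_stk, haltList_stk] at this
  exact this

/-- The number of push instructions in a statement. -/
def pushes : TM2.Stmt tm.Γ tm.Λ tm.σ → ℕ
  | .push _ _ q => pushes q + 1
  | .peek _ _ q => pushes q
  | .pop _ _ q => pushes q
  | .load _ q => pushes q
  | .branch _ q₁ q₂ => pushes q₁ + pushes q₂
  | .goto _ => 0
  | .halt => 0

theorem length_stepAux_le (q : TM2.Stmt tm.Γ tm.Λ tm.σ) (v : tm.σ) (S : ∀ k, List (tm.Γ k))
    (k : tm.K) : ((TM2.stepAux q v S).stk k).length ≤ (S k).length + pushes q := by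
  induction q generalizing v S with
  | push k' f q ih =>
    refine (ih _ _).trans ?_
    by_cases h : k = k'
    · subst h; simp [pushes]; omega
    · simp [pushes, h]
  | peek k' f q ih => exact ih _ _
  | pop k' f q ih =>
    refine (ih _ _).trans ?_
    by_cases h : k = k'
    · subst h; simp [pushes]
    · simp [pushes, h]
  | load a q ih => exact ih _ _
  | branch p q₁ q₂ ih₁ ih₂ =>
    have h₁ := ih₁ v S
    have h₂ := ih₂ v S
    cases h : p v <;> simp [pushes, h] <;> omega
  | goto l => simp [pushes]
  | halt => simp [pushes]

variable (tm) in
/-- A bound for the number of symbols that `tm` can push in one step. -/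
noncomputable def growth : ℕ := haveI := tm.ΛFin; ∑ l, pushes (tm.m l)

theorem pushes_le_growth (l : tm.Λ) : pushes (tm.m l) ≤ growth tm := by
  let := tm.ΛFin
  exact Finset.single_le_sum (f := fun l => pushes (tm.m l)) (fun _ _ => Nat.zero_le _)
    (Finset.mem_univ l)

theorem length_iterate_le (c c' : TM2.Cfg tm.Γ tm.Λ tm.σ) (t : ℕ)
    (h : (flip Bind.bind tm.step)^[t] (some c) = some c') (k : tm.K) :
    (c'.stk k).length ≤ (c.stk k).length + t * growth tm := by
  induction t generalizing c with
  | zero => cases h; simp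
  | succ t ih =>
    obtain ⟨l, v, S⟩ := c
    rw [Function.iterate_succ_apply] at h
    cases l with
    | none => exact absurd (h.symm.trans (iterate_bind_none _ t)) (by simp)
    | some l =>
      have h1 := ih _ h
      have h2 := length_stepAux_le (tm.m l) v S k
      have h3 := pushes_le_growth l
      rw [add_mul, one_mul]
      simp only at h1 ⊢
      omega

/-- A stack grows by at most `growth tm` per step. The bound is needed because fetching and
decrementing the threshold takes time depending on its number of digits. -/
theorem length_output_le {i : List (tm.Γ tm.k₀)} {o : List (tm.Γ tm.k₁)} {t : ℕ}
    (h : TM2OutputsInTime tm i (some o) t) : o.length ≤ i.length + t * growth tm := by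
  have h1 := length_iterate_le _ _ _ h.evals_in_steps tm.k₁
  rw [haltList_stk, initList_stk, single, Function.update_self] at h1
  -- Input and output stack may coincide.
  have h2 : (single tm tm.k₀ i tm.k₁).length ≤ i.length := by
    by_cases h : tm.k₁ = tm.k₀
    · rw [single]
      generalize tm.k₁ = k at h
      subst h; simp
    · simp [h]
  have h3 := Nat.mul_le_mul_right (growth tm) h.steps_le_m
  omega

end embed

/-! ### Little-endian binary numerals. -/

/-- The value of a little-endian binary numeral. -/
def bitsVal : List Bool → ℕ
  | [] => 0
  | b :: l => b.toNat + 2 * bitsVal l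

theorem bitsVal_encodePosNum (p : PosNum) : bitsVal (Computability.encodePosNum p) = p := by
  induction p with
  | one => rfl
  | bit0 p ih => simp [Computability.encodePosNum, bitsVal, ih, PosNum.cast_bit0]; omega
  | bit1 p ih => simp [Computability.encodePosNum, bitsVal, ih, PosNum.cast_bit1]; omega

theorem bitsVal_encodeNat (m : ℕ) : bitsVal (Computability.encodeNat m) = m := by
  have h : ((m : Num) : ℕ) = m := Num.to_of_nat m
  rw [Computability.encodeNat]
  cases hm : (m : Num) with
  | zero => rw [hm] at h; exact h
  | pos p => rw [hm] at h; exact (bitsVal_encodePosNum p).trans h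

theorem bitsVal_append (l l' : List Bool) :
    bitsVal (l ++ l') = bitsVal l + 2 ^ l.length * bitsVal l' := by
  induction l with
  | nil => simp [bitsVal]
  | cons b l ih => simp [bitsVal, ih, pow_succ]; ring

theorem bitsVal_lt (l : List Bool) : bitsVal l < 2 ^ l.length := by
  induction l with
  | nil => simp [bitsVal]
  | cons b l ih => cases b <;> simp [bitsVal, pow_succ] <;> omega

theorem bitsVal_replicate_false (z : ℕ) : bitsVal (List.replicate z false) = 0 := by
  induction z with
  | zero => rfl
  | succ z ih => simp [List.replicate_succ, bitsVal, ih]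

theorem bitsVal_replicate_true (z : ℕ) : bitsVal (List.replicate z true) + 1 = 2 ^ z := by
  induction z with
  | zero => rfl
  | succ z ih => simp [List.replicate_succ, bitsVal, pow_succ]; omega

theorem bitsVal_inj {l l' : List Bool} (h : l.length = l'.length) (hv : bitsVal l = bitsVal l') :
    l = l' := by
  induction l generalizing l' with
  | nil => exact (List.length_eq_zero_iff.1 h.symm).symm
  | cons b l ih =>
    obtain _ | ⟨b', l'⟩ := l'
    · simp at h
    simp only [bitsVal] at hv
    have hb : b = b' := by cases b <;> cases b' <;> simp at hv ⊢ <;> omega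
    subst hb
    rw [ih (by simpa using h) (by omega)]

/-- A string either consists of copies of `b` or has a first occurrence of `!b`. -/
theorem replicate_or_exists (b : Bool) (q : List Bool) :
    q = List.replicate q.length b ∨ ∃ z q', q = List.replicate z b ++ (!b) :: q' := by
  induction q with
  | nil => exact .inl rfl
  | cons c q ih =>
    by_cases hc : c = b
    · subst hc
      rcases ih with h | ⟨z, q', h⟩
      · exact .inl (by rw [List.length_cons, List.replicate_succ, ← h])
      · exact .inr ⟨z + 1, q', by rw [List.replicate_succ, h]; rfl⟩
    · exact .inr ⟨0, q, by cases b <;> cases c <;> simp_all⟩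

/-- The carry rule, used from left to right to decrement the threshold and from right to left to
increment the choice bits. -/
theorem bitsVal_succ (z : ℕ) (q : List Bool) :
    bitsVal (List.replicate z false ++ true :: q) =
      bitsVal (List.replicate z true ++ false :: q) + 1 := by
  have := bitsVal_replicate_true z
  simp [bitsVal_append, bitsVal_replicate_false, bitsVal]
  rw [← this]; ring

/-! ### Computing n and n - f(n). -/

section phases

variable {tm : FinTM2} {eIn : tm.Γ tm.k₀ ≃ Bool} {eOut : tm.Γ tm.k₁ ≃ Bool}
  {g : ∀ k, List (tm.Γ k)} {W V U T P Q : List Bool} {N M : List Unit} {D E : List (Option Bool)}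

/-- The symbols read so far always number a square, with root `N.length`. A full round reads 2m + 1
symbols in 2m + 3 steps, which the factor 3 covers. -/
theorem sq_run (hV : V.length = N.length * N.length) :
    (∃ N' : List Unit, N'.length * N'.length = V.length + W.length ∧
      Runs eIn eOut (cfg .sq0 ⟨g, W, V, N, [], U, T, D, E, P, Q⟩)
        (cfg .copy ⟨g, [], W.reverse ++ V, N', [], U, T, D, E, P, Q⟩) (3 * W.length + 1)) ∨
    ((∀ n, n * n ≠ V.length + W.length) ∧ ∃ s' : Stacks tm,
      Runs eIn eOut (cfg .sq0 ⟨g, W, V, N, [], U, T, D, E, P, Q⟩) (cfg (.clean false) s')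
        (3 * W.length + 1) ∧ s'.g = g ∧
      s'.size ≤ (⟨g, W, V, N, [], U, T, D, E, P, Q⟩ : Stacks tm).size + W.length) := by
  induction hm : W.length using Nat.strong_induction_on generalizing W V N with
  | _ m ih =>
  subst hm
  obtain _ | ⟨b, W⟩ := W
  · exact .inl ⟨N, by simp [hV], sq0_nil⟩
  by_cases hW : 2 * N.length ≤ W.length
  · obtain ⟨l₁, W₁, rfl, h₁⟩ : ∃ l W', W = l ++ W' ∧ l.length = N.length :=
      ⟨W.take N.length, W.drop N.length, by simp, by simp; omega⟩
    obtain ⟨l₂, W₂, rfl, h₂⟩ : ∃ l W', W₁ = l ++ W' ∧ l.length = N.length :=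
      ⟨W₁.take N.length, W₁.drop N.length, by simp, by simp at hW ⊢; omega⟩
    have run : Runs eIn eOut (cfg .sq0 ⟨g, b :: (l₁ ++ (l₂ ++ W₂)), V, N, [], U, T, D, E, P, Q⟩)
        (cfg .sq0 ⟨g, W₂, l₂.reverse ++ (l₁.reverse ++ b :: V), () :: (N ++ []) ++ [], [], U, T, D,
          E, P, Q⟩) (1 + (l₁.length + 1) + (l₂.length + 1)) :=
      ((sq0_cons b).trans (sq1_run l₁ h₁.symm)).trans (sq2_run l₂ (by simp [h₂]))
    have hlen : (l₂.reverse ++ (l₁.reverse ++ b :: V)).length =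
        (() :: (N ++ []) ++ []).length * (() :: (N ++ []) ++ []).length := by
      simp [h₁, h₂, hV]; ring
    rcases ih W₂.length (by simp; omega) hlen rfl with ⟨N', h, r⟩ | ⟨h, s', r, hg, hs⟩
    · refine .inl ⟨N', h.trans (by simp; omega), ((run.trans r).congr (by simp)).mono ?_⟩
      simp; omega
    · refine .inr ⟨fun n => ?_, s', (run.trans r).mono (by simp; omega), hg, ?_⟩
      · convert h n using 1; simp; omega
      · simp [Stacks.size] at hs ⊢; omega
  -- The round cannot be completed, so the total length lies strictly between two consecutive
  -- squares.
  · refine .inr ⟨fun n hn => ?_, ?_⟩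
    · have h1 : N.length < n := by
        by_contra hc
        have := Nat.mul_le_mul (not_lt.1 hc) (not_lt.1 hc)
        simp at hn; omega
      have h2 := Nat.mul_le_mul h1 h1
      have h3 : (N.length + 1) * (N.length + 1) = N.length * N.length + 2 * N.length + 1 := by ring
      simp at hn; simp only [Nat.succ_eq_add_one] at h2; omega
    · by_cases hW' : W.length < N.length
      · obtain ⟨s', r, hg, hs⟩ := sq1_fail (eIn := eIn) (eOut := eOut) (g := g) (V := b :: V)
          (M := []) (U := U) (T := T) (D := D) (E := E) (P := P) (Q := Q) hW'
        exact ⟨s', ((sq0_cons b).trans r).mono (by simp; omega), hg,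
          hs.trans (by simp [Stacks.size]; omega)⟩
      · obtain ⟨l₁, W₁, rfl, h₁⟩ : ∃ l W', W = l ++ W' ∧ l.length = N.length :=
          ⟨W.take N.length, W.drop N.length, by simp, by simp; omega⟩
        obtain ⟨s', r, hg, hs⟩ := sq2_fail (eIn := eIn) (eOut := eOut) (g := g) (W := W₁)
          (V := l₁.reverse ++ b :: V) (N := []) (M := N ++ []) (U := U) (T := T) (D := D) (E := E)
          (P := P) (Q := Q) (by simp at hW ⊢; omega)
        exact ⟨s', (((sq0_cons b).trans (sq1_run l₁ h₁.symm)).trans r).mono (by simp; omega), hg,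
          hs.trans (by simp [Stacks.size]; omega)⟩

theorem dec_step (z : ℕ) (b : Bool) :
    Runs eIn eOut
      (cfg .dec1 ⟨g, W, V, N, M, b :: U, T, D, E, [], List.replicate z false ++ true :: Q⟩)
      (cfg .dec1 ⟨g, W, V, N, M, U, T, D, E, [], List.replicate z true ++ false :: Q⟩)
      (2 * (z + Q.length + 1) + 1) :=
  (((dec1_succ z b).trans dec2_run).congr (by simp)).mono (by simp; omega)

/-- A decrement preserves the number of digits, so every round obeys the same time bound. The digits
left on `P` are never read and stay there until the final cleaning. -/
theorem dec_run (a : ℕ) (h : bitsVal Q ≤ a) :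
    ∃ P' : List Bool, P'.length = Q.length ∧
      Runs eIn eOut (cfg .dec1 ⟨g, W, V, N, M, List.replicate a false, T, D, E, [], Q⟩)
        (cfg .rV ⟨g, W, V, N, M, List.replicate (a - bitsVal Q) false, T, D, E, P', []⟩)
        ((a + 1) * (2 * Q.length + 1)) := by
  induction a generalizing Q with
  | zero =>
    rcases replicate_or_exists false Q with hQ | ⟨z, q, rfl⟩
    · rw [hQ, bitsVal_replicate_false]
      exact ⟨List.replicate Q.length true ++ [], by simp, (dec1_zero _).mono (by simp; omega)⟩
    · simp only [Bool.not_false, bitsVal_succ] at h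
      omega
  | succ a ih =>
    rcases replicate_or_exists false Q with hQ | ⟨z, q, rfl⟩
    · rw [hQ, bitsVal_replicate_false]
      exact ⟨List.replicate Q.length true ++ [], by simp, (dec1_zero _).mono (by simp; nlinarith)⟩
    · simp only [Bool.not_false, bitsVal_succ] at h ⊢
      obtain ⟨P', hP, r⟩ := ih (Nat.le_of_succ_le_succ h)
      refine ⟨P', by simpa using hP, ?_⟩
      rw [Nat.add_sub_add_right]
      refine ((dec_step z false).trans r).mono ?_
      simp
      nlinarith

theorem dec_fail (a : ℕ) (h : a < bitsVal Q) :
    ∃ s' : Stacks tm, Runs eIn eOut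
      (cfg .dec1 ⟨g, W, V, N, M, List.replicate a false, T, D, E, [], Q⟩)
      (cfg (.clean false) s') ((a + 1) * (2 * Q.length + 1)) ∧ s'.g = g ∧
      s'.size ≤ (⟨g, W, V, N, M, List.replicate a false, T, D, E, [], Q⟩ : Stacks tm).size := by
  rcases replicate_or_exists false Q with hQ | ⟨z, q, rfl⟩
  · rw [hQ, bitsVal_replicate_false] at h
    omega
  induction a generalizing z q with
  | zero =>
    exact ⟨_, (dec1_fail z).mono (by simp; omega), rfl, by simp [Stacks.size]; omega⟩
  | succ a ih =>
    simp only [Bool.not_false, bitsVal_succ] at h ⊢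
    rcases replicate_or_exists false (List.replicate z true ++ false :: q) with hQ | ⟨z', q', hQ⟩
    · rw [hQ, bitsVal_replicate_false] at h
      omega
    · rw [hQ] at h
      obtain ⟨s', r, hg, hs⟩ := ih z' q' (by omega)
      rw [← hQ] at r hs
      refine ⟨s', ((dec_step z false).trans r).mono ?_, hg, hs.trans ?_⟩
      · simp
        nlinarith
      · simp [Stacks.size]

end phases

/-! ### The bounded search tree for vertex cover. -/

/-- Scan the positions `p, p + 1, …` of a matrix with `n` columns and entries `w`, where `d` is
the set of deleted vertices: whenever an entry is `false` and neither its row nor its column is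
deleted, the next bit decides which of the two is deleted. The scan fails if the bits run out. -/
def scan (n : ℕ) : List Bool → ℕ → Finset ℕ → List Bool → Bool
  | [], _, _, _ => true
  | b :: w, p, d, u =>
    if b = false ∧ p / n ∉ d ∧ p % n ∉ d then
      match u with
      | [] => false
      | x :: u => scan n w (p + 1) (insert (if x then p / n else p % n) d) u
    else scan n w (p + 1) d u

/-- Any cover contains the row or the column vertex of the first uncovered false entry, so following
both choices loses nothing. Position, deleted set and budget vary in the induction along the matrix.
Unused bits are harmless, hence strings of length exactly `k` account for at most `k` deletions. -/
theorem exists_scan_iff (n : ℕ) (w : List Bool) (p : ℕ) (d : Finset ℕ) (k : ℕ) :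
    (∃ u : List Bool, u.length = k ∧ scan n w p d u = true) ↔
      ∃ C : Finset ℕ, d ⊆ C ∧ (C \ d).card ≤ k ∧
        ∀ q (hq : q < w.length), w[q] = false → (p + q) / n ∈ C ∨ (p + q) % n ∈ C := by
  induction w generalizing p d k with
  | nil =>
    exact ⟨fun _ => ⟨d, subset_rfl, by simp, by simp⟩,
      fun _ => ⟨List.replicate k true, by simp, rfl⟩⟩
  | cons b w ih =>
    have split (C : Finset ℕ) :
        (∀ q (hq : q < (b :: w).length), (b :: w)[q] = false →
          (p + q) / n ∈ C ∨ (p + q) % n ∈ C) ↔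
        (b = false → p / n ∈ C ∨ p % n ∈ C) ∧
        ∀ q (hq : q < w.length), w[q] = false → (p + 1 + q) / n ∈ C ∨ (p + 1 + q) % n ∈ C := by
      constructor
      · intro h
        refine ⟨fun hb => by simpa using h 0 (by simp) (by simpa using hb), fun q hq hw => ?_⟩
        have := h (q + 1) (by simpa using hq) (by simpa using hw)
        rwa [show p + (q + 1) = p + 1 + q by omega] at this
      · rintro ⟨h0, h1⟩ (_ | q) hq hw
        · simpa using h0 (by simpa using hw)
        · have := h1 q (by simpa using hq) (by simpa using hw)
          rwa [show p + 1 + q = p + (q + 1) by omega] at this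
    simp only [split]
    by_cases hc : b = false ∧ p / n ∉ d ∧ p % n ∉ d
    · obtain ⟨hb, hi, hj⟩ := hc
      cases k with
      | zero =>
        constructor
        · rintro ⟨u, hu, h⟩
          obtain rfl := List.length_eq_zero_iff.1 hu
          simp [scan, hb, hi, hj] at h
        · rintro ⟨C, hd, hC, h, -⟩
          have hCd : C ⊆ d := by simpa using hC
          rcases h hb with h | h
          · exact absurd (hCd h) hi
          · exact absurd (hCd h) hj
      | succ k =>
        -- Deleting a new vertex of `C` uses up exactly one unit of the budget.
        have step (v : ℕ) (hv : v ∉ d) (C : Finset ℕ) :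
            (insert v d ⊆ C ∧ (C \ insert v d).card ≤ k) ↔
              (d ⊆ C ∧ (C \ d).card ≤ k + 1 ∧ v ∈ C) := by
          rw [Finset.insert_subset_iff]
          constructor
          · rintro ⟨⟨hvC, hd⟩, h⟩
            refine ⟨hd, ?_, hvC⟩
            rw [Finset.sdiff_insert, Finset.card_erase_of_mem (by simp [hvC, hv])] at h
            omega
          · rintro ⟨hd, h, hvC⟩
            refine ⟨⟨hvC, hd⟩, ?_⟩
            rw [Finset.sdiff_insert, Finset.card_erase_of_mem (by simp [hvC, hv])]
            omega
        constructor
        · rintro ⟨u, hu, h⟩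
          obtain _ | ⟨x, u⟩ := u
          · simp at hu
          simp only [scan, hb, hi, hj, not_false_eq_true, and_self, if_true] at h
          obtain ⟨C, h1, h2, h3⟩ := (ih _ _ k).1 ⟨u, by simpa using hu, h⟩
          cases x
          · obtain ⟨h4, h5, h6⟩ := (step _ hj C).1 ⟨by simpa using h1, by simpa using h2⟩
            exact ⟨C, h4, h5, fun _ => .inr h6, h3⟩
          · obtain ⟨h4, h5, h6⟩ := (step _ hi C).1 ⟨by simpa using h1, by simpa using h2⟩
            exact ⟨C, h4, h5, fun _ => .inl h6, h3⟩
        · rintro ⟨C, h1, h2, h3, h4⟩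
          have key (x : Bool) (hx : (if x then p / n else p % n) ∉ d)
              (hxC : (if x then p / n else p % n) ∈ C) :
              ∃ u : List Bool, u.length = k + 1 ∧ scan n (b :: w) p d u = true := by
            obtain ⟨h5, h6⟩ := (step _ hx C).2 ⟨h1, h2, hxC⟩
            obtain ⟨u, hu, h⟩ := (ih _ _ k).2 ⟨C, h5, h6, h4⟩
            exact ⟨x :: u, by simp [hu], by simpa [scan, hb, hi, hj] using h⟩
          rcases h3 hb with h | h
          · exact key true hi h
          · exact key false hj h
    -- No choice is made here: the entry is true or already covered by `d`, hence by every `C ⊇ d`.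
    · simp only [scan, if_neg hc, ih]
      refine exists_congr fun C => and_congr_right fun hd => and_congr_right fun _ => ?_
      refine (and_iff_right fun hb => ?_).symm
      by_contra hcon
      exact hc ⟨hb, fun h => hcon (.inl (hd h)), fun h => hcon (.inr (hd h))⟩

/-! ### The scan and the search on the machine. -/

/-- The entry for vertex `j` in the deletion array while row `i` is processed. -/
def cell (i : ℕ) (d : Finset ℕ) (j : ℕ) : Option Bool :=
  if j = i then none else some (decide (j ∈ d))

/-- Deleting the current row changes only the label, since the cell of that row holds the marker. -/
theorem cell_insert_self (i : ℕ) (d : Finset ℕ) : cell i (insert i d) = cell i d := by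
  funext j
  by_cases h : j = i <;> simp [cell, h]

theorem map_cell_insert (i j : ℕ) (d : Finset ℕ) (l : List ℕ) (hl : j ∉ l) :
    l.map (cell i (insert j d)) = l.map (cell i d) :=
  List.map_congr_left fun x hx => by
    have : x ≠ j := fun h => hl (h ▸ hx)
    simp [cell, this]

theorem map_cell_of_notMem (i : ℕ) (d : Finset ℕ) (l : List ℕ) (hl : i ∉ l) :
    l.map (cell i d) = (l.map fun x => decide (x ∈ d)).map some := by
  rw [List.map_map]
  exact List.map_congr_left fun x hx => by
    have : x ≠ i := fun h => hl (h ▸ hx)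
    simp [cell, this]

section phases

variable {tm : FinTM2} {eIn : tm.Γ tm.k₀ ≃ Bool} {eOut : tm.Γ tm.k₁ ≃ Bool}
  {g : ∀ k, List (tm.Γ k)} {W V U T P Q : List Bool} {N M : List Unit} {D E : List (Option Bool)}

/-- The array is split around the cells `i` and `i + 1`, the only two that change; the others are
copied back. -/
theorem row_end {n i : ℕ} (hi : i + 1 < n) (d : Finset ℕ) (b : Bool) :
    Runs eIn eOut
      (cfg (.pass (decide (i ∈ d))) ⟨g, b :: W, V, N, M, U, T, [],
        ((List.range n).map (cell i d)).reverse, P, Q⟩)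
      (cfg (.pass (decide (i + 1 ∈ d))) ⟨g, b :: W, V, N, M, U, T,
        (List.range n).map (cell (i + 1) d), [], P, Q⟩) (n + 2) := by
  obtain ⟨m, rfl⟩ := Nat.exists_eq_add_of_lt hi
  have hr : List.range (i + 1 + m + 1) = List.range i ++ i :: (i + 1) :: List.range' (i + 2) m := by
    rw [show i + 1 + m + 1 = i + (m + 2) by omega, List.range_add, ← List.range'_eq_map_range,
      List.range'_succ, List.range'_succ]
  have h1 : (List.range (i + 1 + m + 1)).map (cell i d) =
      ((List.range i).map fun x => decide (x ∈ d)).map some ++ none :: some (decide (i + 1 ∈ d)) ::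
        ((List.range' (i + 2) m).map fun x => decide (x ∈ d)).map some := by
    rw [hr, List.map_append, List.map_cons, List.map_cons, map_cell_of_notMem _ _ _ (by simp),
      map_cell_of_notMem _ _ _ (by simp)]
    simp [cell]
  have h2 : (List.range (i + 1 + m + 1)).map (cell (i + 1) d) =
      ((List.range i).map fun x => decide (x ∈ d)).map some ++ some (decide (i ∈ d)) :: none ::
        ((List.range' (i + 2) m).map fun x => decide (x ∈ d)).map some := by
    rw [hr, List.map_append, List.map_cons, List.map_cons, map_cell_of_notMem _ _ _ (by simp),
      map_cell_of_notMem _ _ _ (by simp)]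
    simp [cell]
  rw [h1, h2]
  generalize h3 : ((List.range i).map fun x => decide (x ∈ d)) = l₁
  generalize h4 : ((List.range' (i + 2) m).map fun x => decide (x ∈ d)) = l₂
  have hl₁ : l₁.length = i := by simp [← h3]
  have hl₂ : l₂.length = m := by simp [← h4]
  have r1 := restore_some (eIn := eIn) (eOut := eOut) (g := g) (W := b :: W) (V := V) (N := N)
    (M := M) (U := U) (T := T) (D := []) (E := none :: (l₁.map some).reverse) (P := P) (Q := Q)
    (decide (i ∈ d)) (l₂.reverse ++ [decide (i + 1 ∈ d)])
  have r2 := restore_mark (eIn := eIn) (eOut := eOut) (g := g) (W := b :: W) (V := V) (N := N)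
    (M := M) (U := U) (T := T) (D := l₂.map some) (E := (l₁.map some).reverse) (P := P) (Q := Q)
    (decide (i ∈ d)) (decide (i + 1 ∈ d))
  have r3 := restore_some (eIn := eIn) (eOut := eOut) (g := g) (W := b :: W) (V := V) (N := N)
    (M := M) (U := U) (T := T) (D := some (decide (i ∈ d)) :: none :: l₂.map some) (E := [])
    (P := P) (Q := Q) (decide (i + 1 ∈ d)) l₁.reverse
  simp only [List.map_append, List.map_reverse, List.map_cons, List.map_nil, List.reverse_append,
    List.reverse_cons, List.reverse_nil, List.nil_append, List.append_assoc, List.cons_append,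
    List.reverse_reverse, List.append_nil] at r1 r3 ⊢
  refine (((((pass_row_end _ _).trans r1).trans r2).trans r3).trans (restore_nil _)).mono ?_
  simp [hl₁, hl₂]
  omega

/-- The stacks at column `j` of row `i` of a scan. -/
def rowState (g : ∀ k, List (tm.Γ k)) (M : List Unit) (P : List Bool) (n i j : ℕ) (d : Finset ℕ)
    (W V U T : List Bool) : Stacks tm :=
  ⟨g, W, V, [], M, U, T, (List.range' j (n - j)).map (cell i d),
    ((List.range j).map (cell i d)).reverse, P, []⟩

/-- The matrix `w` and the bits `b` are recoverable from the stacks `s`. -/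
structure Inv (g : ∀ k, List (tm.Γ k)) (M : List Unit) (P : List Bool) (n : ℕ) (w b : List Bool)
    (s : Stacks tm) : Prop where
  hg : s.g = g
  hN : s.N = []
  hM : s.M = M
  hP : s.P = P
  hQ : s.Q = []
  hw : s.V.reverse ++ s.W = w
  hb : s.T.reverse ++ s.U = b
  -- The extra 1 is for n = 0, where the array still consists of the marker.
  hD : s.D.length + s.E.length ≤ n + 1

theorem Inv.size_le {n : ℕ} {w b : List Bool} {s : Stacks tm} (h : Inv g M P n w b s) :
    s.size ≤ w.length + M.length + b.length + (n + 1) + P.length := by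
  obtain ⟨h1, h2, h3, h4, h5, h6, h7, h8⟩ := h
  simp only [Stacks.size, h2, h3, h4, h5, ← h6, ← h7, List.length_append, List.length_reverse,
    List.length_nil]
  omega

/-- An entry costs one step, and at most n + 2 more if a row ends there. The last row is not
followed by a rewind, because `pass` tests `W` before `D`; so j = n may occur once `W` is empty. -/
theorem pass_run (n : ℕ) (w bits : List Bool) (i j : ℕ) (d : Finset ℕ)
    (hlen : W.length + i * n + j = n * n) (hij : W ≠ [] → i < n ∧ j < n) (hj : j ≤ n)
    (hw : V.reverse ++ W = w) (hb : T.reverse ++ U = bits) :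
    ∃ s', Runs eIn eOut (cfg (.pass (decide (i ∈ d))) (rowState g M P n i j d W V U T))
      (cfg (if scan n W (i * n + j) d U then .clean true else .moveT true) s')
      (W.length * (n + 3) + 1) ∧ Inv g M P n w bits s' := by
  induction W generalizing i j d V U T with
  | nil =>
    exact ⟨_, by simpa [scan, rowState] using pass_nil _, rfl, rfl, rfl, rfl, rfl, hw, hb,
      by simp; omega⟩
  | cons b W ih =>
    obtain ⟨hi', hj'⟩ := hij (by simp)
    have hlen' : W.length + i * n + (j + 1) = n * n := by simp at hlen; omega
    -- One form for both continuations, within the row and into the next one; the summand n + 2 pays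
    -- for the change of row.
    have next (d' : Finset ℕ) (U' T' V' : List Bool) (hw' : V'.reverse ++ W = w)
        (hb' : T'.reverse ++ U' = bits) :
        ∃ s', Runs eIn eOut (cfg (.pass (decide (i ∈ d'))) (rowState g M P n i (j + 1) d' W V' U' T'))
          (cfg (if scan n W (i * n + j + 1) d' U' then .clean true else .moveT true) s')
          (n + 2 + (W.length * (n + 3) + 1)) ∧ Inv g M P n w bits s' := by
      by_cases hW : W ≠ [] ∧ j + 1 = n
      · obtain ⟨hW, rfl⟩ := hW
        obtain ⟨c, W, rfl⟩ := List.exists_cons_of_ne_nil hW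
        have hi1 : i + 1 < j + 1 := by
          by_contra hc
          have := Nat.mul_le_mul_right (j + 1) (not_lt.1 hc)
          rw [add_mul i 1, one_mul] at this
          simp at hlen'; omega
        obtain ⟨s', r, hs⟩ := ih (i + 1) 0 d' (by rw [add_mul]; omega) (fun _ => ⟨hi1, by omega⟩)
          (by omega) hw' hb'
        refine ⟨s', ?_, hs⟩
        rw [show (i + 1) * (j + 1) + 0 = i * (j + 1) + j + 1 by ring] at r
        have re := row_end (eIn := eIn) (eOut := eOut) (g := g) (W := W) (V := V') (N := [])
          (M := M) (U := U') (T := T') (P := P) (Q := []) hi1 d' c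
        refine Runs.trans (c' := cfg _ _) ?_ r
        simpa [rowState, List.range_eq_range'] using re
      · obtain ⟨s', r, hs⟩ := ih i (j + 1) d' hlen' (fun h => ⟨hi', by
          by_contra hc; exact hW ⟨h, by omega⟩⟩) (by omega) hw' hb'
        exact ⟨s', r.mono (by omega), hs⟩
    have hD (d' : Finset ℕ) : (List.range' j (n - j)).map (cell i d') =
        cell i d' j :: (List.range' (j + 1) (n - (j + 1))).map (cell i d') := by
      rw [show n - j = n - (j + 1) + 1 by omega, List.range'_succ, List.map_cons]
    have hE (d' : Finset ℕ) : ((List.range (j + 1)).map (cell i d')).reverse =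
        cell i d' j :: ((List.range j).map (cell i d')).reverse := by
      simp [List.range_succ]
    have hdiv : (i * n + j) / n = i := by
      rw [mul_comm, Nat.mul_add_div (by omega), Nat.div_eq_of_lt hj', add_zero]
    have hmod : (i * n + j) % n = j := by
      rw [mul_comm, Nat.mul_add_mod, Nat.mod_eq_of_lt hj']
    have htime : 1 + (n + 2 + (W.length * (n + 3) + 1)) ≤ (b :: W).length * (n + 3) + 1 := by
      rw [List.length_cons, add_mul]; omega
    by_cases hc : b = false ∧ i ∉ d ∧ j ∉ d
    · obtain ⟨rfl, hid, hjd⟩ := hc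
      have hcell : cell i d j ≠ some true := by
        unfold cell; split_ifs <;> simp [hjd]
      obtain _ | ⟨x, U⟩ := U
      · refine ⟨⟨g, W, false :: V, [], M, [], T,
          (List.range' (j + 1) (n - (j + 1))).map (cell i d),
          ((List.range j).map (cell i d)).reverse, P, []⟩, ?_,
          rfl, rfl, rfl, rfl, rfl, by simpa using hw, hb, by simp; omega⟩
        rw [rowState, hD, show decide (i ∈ d) = false by simpa using hid]
        simp only [scan, hdiv, hmod, hid, hjd, not_false_eq_true, and_self, if_true,
          Bool.false_eq_true, if_false]
        exact (pass_fail _ hcell).mono (by omega)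
      · simp only [scan, hdiv, hmod, hid, hjd, not_false_eq_true, and_self, if_true]
        -- On the diagonal row and column vertex agree, so the bit is irrelevant and the machine
        -- treats the deletion as one of the row.
        by_cases hx : x = true ∨ i = j
        · obtain ⟨s', r, hs⟩ := next (insert i d) U (x :: T) (false :: V) (by simpa using hw)
            (by simpa using hb)
          refine ⟨s', ?_, hs⟩
          rw [show (if x = true then i else j) = i by rcases hx with rfl | rfl <;> simp]
          refine (Runs.trans (c' := cfg _ _) ?_ r).mono htime
          rw [rowState, rowState, hD, hE, cell_insert_self]
          simp only [decide_false, Finset.mem_insert_self, decide_true]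
          exact pass_row _ _ hcell (hx.imp_right fun h => by simp [cell, h])
        · push Not at hx
          obtain ⟨s', r, hs⟩ := next (insert j d) U (x :: T) (false :: V) (by simpa using hw)
            (by simpa using hb)
          refine ⟨s', ?_, hs⟩
          obtain ⟨hx, hne⟩ := hx
          simp only [Bool.not_eq_true] at hx
          subst hx
          simp only [Bool.false_eq_true, if_false]
          refine (Runs.trans (c' := cfg _ _) ?_ r).mono htime
          rw [rowState, rowState, hD, hE, map_cell_insert _ _ _ _ (by simp),
            map_cell_insert _ _ _ _ (by simp)]
          simp only [hid, decide_false, Finset.mem_insert, hne, or_self, cell, hne.symm, if_false,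
            hjd, true_or, decide_true]
          exact pass_col
    · simp only [scan, hdiv, hmod, if_neg hc]
      obtain ⟨s', r, hs⟩ := next d U T (b :: V) (by simpa using hw) hb
      refine ⟨s', (Runs.trans (c' := cfg _ _) ?_ r).mono htime, hs⟩
      rw [rowState, rowState, hD, hE]
      refine pass_skip _ _ _ ?_
      by_cases h1 : b = true
      · exact .inl h1
      by_cases h2 : i ∈ d
      · exact .inr (.inl (by simpa using h2))
      have h3 : j ∈ d := by
        by_contra h3; exact hc ⟨by simpa using h1, h2, h3⟩
      have h4 : j ≠ i := fun h => h2 (h ▸ h3)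
      exact .inr (.inr (by simp [cell, h3, h4]))

theorem reset_run :
    Runs eIn eOut (cfg .rV ⟨g, W, V, [], M, U, T, D, E, P, Q⟩)
      (cfg (.pass false) ⟨g, V.reverse ++ W, [], [], M, T.reverse ++ U, [],
        none :: List.replicate (M.length - 1) (some false), [], P, Q⟩)
      (V.length + T.length + D.length + E.length + 2 * M.length + 5) := by
  refine (((((rV_run.trans (moveT_run false)).trans rD_run).trans bD_run).trans bD2_run).congr
    ?_).mono ?_
  · simp
  · simp; omega

/-- `Inv` fixes matrix and bits only up to the head positions, so a trial can start from whatever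
state its predecessor was interrupted in. -/
theorem trial_run {n : ℕ} {w b : List Bool} {s : Stacks tm} (hs : Inv g M P n w b s)
    (hw : w.length = n * n) (hM : M.length = n) :
    ∃ s', Runs eIn eOut (cfg .rV s) (cfg (if scan n w 0 ∅ b then .clean true else .moveT true) s')
      (n * n * (n + 4) + 3 * n + 7 + b.length) ∧ Inv g M P n w b s' := by
  obtain ⟨g', W, V, N, M', U, T, D, E, P', Q⟩ := s
  obtain ⟨rfl, rfl, rfl, rfl, rfl, hsw, hsb, hD⟩ := hs
  simp only at hsw hsb hD hM
  have hr := reset_run (eIn := eIn) (eOut := eOut) (g := g') (W := W) (V := V) (M := M') (U := U)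
    (T := T) (D := D) (E := E) (P := P') (Q := [])
  rw [hsw, hsb] at hr
  have hV : V.length ≤ n * n := by rw [← hw, ← hsw]; simp
  have hT : T.length ≤ b.length := by rw [← hsb]; simp
  obtain rfl | ⟨m, rfl⟩ : n = 0 ∨ ∃ m, n = m + 1 := by
    cases n <;> simp
  · obtain rfl := List.length_eq_zero_iff.1 (show w.length = 0 from hw)
    have r := hr.trans (pass_nil false)
    rw [scan, if_pos rfl]
    exact ⟨⟨g', [], [], [], M', b, [], none :: List.replicate (M'.length - 1) (some false), [], P',
      []⟩, r.mono (by omega), rfl, rfl, rfl, rfl, rfl, rfl, rfl, by simp [hM]⟩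
  · obtain ⟨s', r, h⟩ := pass_run (eIn := eIn) (eOut := eOut) (g := g') (M := M') (P := P')
      (W := w) (V := []) (U := b) (T := []) (m + 1) w b 0 0 ∅ (by simpa using hw)
      (fun _ => by simp) (by simp) rfl rfl
    simp only [Nat.zero_mul, Nat.add_zero] at r
    refine ⟨s', ((hr.congr ?_).trans r).mono ?_, h⟩
    · rw [rowState, Nat.sub_zero, List.range'_succ, List.map_cons, map_cell_of_notMem _ _ _ (by simp)]
      simp [cell, hM]
    · rw [hw]
      nlinarith

/-- The strings are tried in increasing numerical order, so the induction is on the number 2^k -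
`bitsVal b` of strings still to be tried. The time per string is that of a trial, of rewinding the
bits and of an increment. -/
theorem search_run {n k : ℕ} {w b : List Bool} {s : Stacks tm} (hs : Inv g M P n w b s)
    (hw : w.length = n * n) (hM : M.length = n) (hk : b.length = k) :
    ∃ ans s', Runs eIn eOut (cfg .rV s) (cfg (.clean ans) s')
      ((2 ^ k - bitsVal b) * (n * n * (n + 4) + 3 * n + 9 + 3 * k)) ∧ s'.g = g ∧
      s'.size ≤ n * n + n + k + (n + 1) + P.length ∧
      (ans = true ↔ ∃ b' : List Bool, b'.length = k ∧ bitsVal b ≤ bitsVal b' ∧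
        scan n w 0 ∅ b' = true) := by
  induction hm : 2 ^ k - bitsVal b generalizing b s with
  | zero => have := bitsVal_lt b; rw [hk] at this; omega
  | succ m ih =>
    obtain ⟨s₁, r₁, h₁⟩ := trial_run (eIn := eIn) (eOut := eOut) hs hw hM
    by_cases hok : scan n w 0 ∅ b = true
    · rw [if_pos hok] at r₁
      refine ⟨true, s₁, r₁.mono ?_, h₁.hg, ?_, by simpa using ⟨b, hk, le_rfl, hok⟩⟩
      · rw [add_mul, hk]; omega
      · have := h₁.size_le; rwa [hw, hM, hk] at this
    · rw [if_neg hok] at r₁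
      obtain ⟨g', W, V, N, M', U, T, D, E, P', Q⟩ := s₁
      obtain ⟨rfl, rfl, rfl, rfl, rfl, hsw, hsb, hD⟩ := h₁
      simp only at hsw hsb hD hM
      have r₂ := moveT_run (eIn := eIn) (eOut := eOut) (g := g') (W := W) (V := V) (N := [])
        (M := M') (U := U) (T := T) (D := D) (E := E) (P := P') (Q := []) true
      have hT : T.length ≤ k := by rw [← hk, ← hsb]; simp
      rw [hsb, if_pos rfl] at r₂
      -- If all bits are ones, the increment overflows: `b` was the last string, and it has failed.
      rcases replicate_or_exists true b with hbt | ⟨z, q, hbq⟩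
      · have r₃ := inc_fail (eIn := eIn) (eOut := eOut) (g := g') (W := W) (V := V) (N := [])
          (M := M') (T := []) (D := D) (E := E) (P := P') (Q := []) b.length
        rw [← hbt] at r₃
        refine ⟨false, _, ((r₁.trans r₂).trans r₃).mono ?_, rfl, ?_, ?_⟩
        · rw [add_mul, hk]; omega
        · have : V.length + W.length = n * n := by rw [← hw, ← hsw]; simp
          simp [Stacks.size]
          omega
        · simp only [Bool.false_eq_true, false_iff, not_exists, not_and]
          intro b' hb' hle
          have h1 := bitsVal_replicate_true b.length
          rw [← hbt, hk, ← hb'] at h1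
          have h2 := bitsVal_lt b'
          have h3 : b = b' := bitsVal_inj (hk.trans hb'.symm) (by omega)
          rwa [← h3]
      · rw [Bool.not_true] at hbq
        subst hbq
        have r₃ := inc_succ (eIn := eIn) (eOut := eOut) (g := g') (W := W) (V := V) (N := [])
          (M := M') (T := []) (U := q) (D := D) (E := E) (P := P') (Q := []) z
        have hv : bitsVal (List.replicate z false ++ true :: q) =
          bitsVal (List.replicate z true ++ false :: q) + 1 := bitsVal_succ z q
        obtain ⟨ans, s', r₄, h4, h5, h6⟩ := ih (b := List.replicate z false ++ true :: q)
          (s := ⟨g', W, V, [], M', q, true :: List.replicate z false ++ [], D, E, P', []⟩)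
          ⟨rfl, rfl, rfl, rfl, rfl, hsw, by simp, hD⟩ (by simpa using hk) (by omega)
        refine ⟨ans, s', (((r₁.trans r₂).trans r₃).trans r₄).mono ?_, h4, h5, h6.trans ?_⟩
        · have hz : z + 1 ≤ k := by rw [← hk]; simp
          rw [add_mul m 1, hk]; omega
        · refine exists_congr fun b' => and_congr_right fun hb' => and_congr_left fun hsc => ?_
          rw [hv]
          refine ⟨by omega, fun h => ?_⟩
          -- A successful string with the value of `b` would be `b` itself, which has just failed.
          rcases h.lt_or_eq with h | h
          · exact h
          · exact absurd (bitsVal_inj (hk.trans hb'.symm) h ▸ hsc) hok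

end phases

/-! ### From models to matrices: correctness of the search. -/

theorem mul_add_lt {n i j : ℕ} (hi : i < n) (hj : j < n) : i * n + j < n * n := by
  have := Nat.mul_le_mul_right n (Nat.succ_le_of_lt hi)
  rw [Nat.succ_mul] at this
  omega

theorem mul_add_div {n i j : ℕ} (hj : j < n) : (i * n + j) / n = i := by
  rw [mul_comm, Nat.mul_add_div (by omega), Nat.div_eq_of_lt hj, add_zero]

theorem mul_add_mod {n i j : ℕ} (hj : j < n) : (i * n + j) % n = j := by
  rw [mul_comm, Nat.mul_add_mod, Nat.mod_eq_of_lt hj]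

open Classical in
theorem encode_eq_ofFn (M : FiniteModel) {n : ℕ} (e : Fin n ≃ M.carrier) :
    M.encode e = List.ofFn fun p : Fin (n * n) => decide (M.rel (e p.divNat) (e p.modNat)) := by
  rw [FiniteModel.encode, List.ofFn_mul, List.flatMap, List.ofFn_eq_map]
  congr 1
  refine List.map_congr_left fun i _ => ?_
  rw [List.ofFn_eq_map]
  refine List.map_congr_left fun j _ => ?_
  have h1 (h) : Fin.divNat (⟨i * n + j, h⟩ : Fin (n * n)) = i := Fin.ext (mul_add_div j.2)
  have h2 (h) : Fin.modNat (⟨i * n + j, h⟩ : Fin (n * n)) = j := Fin.ext (mul_add_mod j.2)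
  rw [h1, h2]

/-- The string `w` is an `n * n` matrix, and some choice of `n - f n` bits lets the scan succeed. -/
def Accept (f : ℕ → ℕ) (w : List Bool) : Prop :=
  ∃ n, n * n = w.length ∧ f n ≤ n ∧ ∃ b : List Bool, b.length = n - f n ∧ scan n w 0 ∅ b = true

/-- Complementation exchanges large sets on which the relation is total with small covers of the
false entries. For the converse, the model on `Fin n` is read off from `w`, and the large set
consists of the vertices outside `C`. -/
theorem mem_modelLanguage_iff (f : ℕ → ℕ) (w : List Bool) :
    w ∈ modelLanguage (RamseyQuantifier f) ↔ Accept f w := by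
  classical
  have key (n : ℕ) := exists_scan_iff n w 0 ∅ (n - f n)
  simp only [Finset.empty_subset, Finset.sdiff_empty, true_and, zero_add] at key
  simp only [Accept, key]
  constructor
  · rintro ⟨M, ⟨A, hA, hrel⟩, n, e, rfl⟩
    have hcard : Fintype.card M.carrier = n := by rw [← Fintype.card_congr e, Fintype.card_fin]
    rw [IsLarge, hcard] at hA
    have hAn : A.card ≤ n := hcard ▸ A.card_le_univ
    refine ⟨n, by simp [encode_eq_ofFn], hA.trans hAn, (Aᶜ).image fun a => (e.symm a : ℕ), ?_, ?_⟩
    · refine Finset.card_image_le.trans ?_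
      rw [Finset.card_compl, hcard]
      omega
    · intro q hq hw
      have hq' : q < n * n := by simpa [encode_eq_ofFn] using hq
      have hw' : ¬ M.rel (e (⟨q, hq'⟩ : Fin (n * n)).divNat) (e (⟨q, hq'⟩ : Fin (n * n)).modNat) := by
        simpa [encode_eq_ofFn] using hw
      by_contra hcon
      simp only [Finset.mem_image, Finset.mem_compl, not_or, not_exists, not_and] at hcon
      refine hw' (hrel _ ?_ _ ?_)
      · by_contra h
        exact hcon.1 _ h (by simp)
      · by_contra h
        exact hcon.2 _ h (by simp)
  · rintro ⟨n, hn, hf, C, hC, hcov⟩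
    have hlt (i j : Fin n) : (i : ℕ) * n + j < w.length := hn ▸ mul_add_lt i.2 j.2
    refine ⟨⟨Fin n, fun i j => w[(i : ℕ) * n + j]'(hlt i j) = true⟩,
      ⟨Finset.univ.filter fun i : Fin n => (i : ℕ) ∉ C, ?_, ?_⟩, n, Equiv.refl _, ?_⟩
    · rw [IsLarge]
      have h1 : (Finset.univ.filter fun i : Fin n => (i : ℕ) ∈ C).card ≤ C.card :=
        Finset.card_le_card_of_injOn (fun i => (i : ℕ)) (by simp [Set.MapsTo])
          (Fin.val_injective.injOn)
      have h2 := Finset.card_filter_add_card_filter_not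
        (s := (Finset.univ : Finset (Fin n))) (fun i => (i : ℕ) ∈ C)
      simp only [Finset.card_univ, Fintype.card_fin] at h2 ⊢
      omega
    · intro a ha b hb
      simp only [Finset.mem_filter, Finset.mem_univ, true_and] at ha hb
      by_contra h
      have := hcov _ (hlt a b) (by simpa using h)
      rw [mul_add_div b.2, mul_add_mod b.2] at this
      exact this.elim ha hb
    · refine List.ext_getElem (by simp [encode_eq_ofFn, hn]) fun q h1 h2 => ?_
      simp [encode_eq_ofFn, Nat.div_add_mod']

/-! ### Assembling the machine and its time bound. -/

open Computability

theorem eval_le_eval {p : Polynomial ℕ} {a b : ℕ} (h : a ≤ b) : p.eval a ≤ p.eval b := by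
  simp only [Polynomial.eval_eq_sum, Polynomial.sum]
  gcongr

theorem unaryEncodeNat_eq (n : ℕ) : unaryEncodeNat n = List.replicate n true := by
  induction n with
  | zero => rfl
  | succ n ih => rw [unaryEncodeNat, ih, List.replicate_succ]

section

variable {f : ℕ → ℕ} (h : TM2ComputableInPolyTime unaryEncodeNat encodeNat f)

/-- A bound for the length of the output of the machine computing `f`. -/
noncomputable def outBound : Polynomial ℕ :=
  .X + h.time * .C (growth h.tm)

/-- A bound for the running time before the search starts. -/
noncomputable def prepBound : Polynomial ℕ :=
  .C 3 * .X + 1 + (.X + 1) + h.time + (outBound h + 1) + (outBound h + 1) +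
    (.X + 1) * (.C 2 * outBound h + 1)

/-- A bound for the final contents of the stacks. -/
noncomputable def sizeBound : Polynomial ℕ :=
  .C 5 * .X + .C 2 * outBound h + 1

/-- A bound for the running time, if at most `K (w.length)` strings are searched. -/
noncomputable def timeBound (K : Polynomial ℕ) : Polynomial ℕ :=
  prepBound h + K * (.X * (.X + .C 4) + .C 6 * .X + .C 9) + (sizeBound h + 1)

theorem length_encodeNat_le (n : ℕ) : (encodeNat (f n)).length ≤ (outBound h).eval n := by
  have := length_output_le (h.outputsFun n)
  simpa [outBound, unaryEncodeNat_eq] using this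

/-- The stacks at the start, with input `w`. -/
def start {tm : FinTM2} (w : List Bool) : Stacks tm :=
  ⟨fun _ => [], w, [], [], [], [], [], [], [], [], []⟩

theorem prep_run (n : ℕ) (W V T : List Bool) (N : List Unit) (hN : N.length = n) :
    Runs h.inputAlphabet h.outputAlphabet
      (cfg .copy ⟨fun _ => [], W, V, N, [], [], T, [], [], [], []⟩)
      (cfg .dec1 ⟨fun _ => [], W, V, [], N, List.replicate n false, T, [], [], [],
        encodeNat (f n)⟩)
      (n + 1 + h.time.eval n + ((outBound h).eval n + 1) + ((outBound h).eval n + 1)) := by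
  have hL := length_encodeNat_le h n
  have r1 := copy_run (eIn := h.inputAlphabet) (eOut := h.outputAlphabet) (W := W) (V := V)
    (N := N) (M := []) (U := []) (T := T) (D := []) (E := []) (P := []) (Q := []) []
  have r2 := tm_run (eIn := h.inputAlphabet) (eOut := h.outputAlphabet) (h.outputsFun n) (W := W)
    (V := V) (N := []) (M := N) (U := List.replicate n false) (T := T) (D := []) (E := [])
    (P := []) (Q := [])
  have r3 := fetch_run (eIn := h.inputAlphabet) (eOut := h.outputAlphabet) (W := W)
    (V := V) (N := []) (M := N) (U := List.replicate n false) (T := T) (D := []) (E := [])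
    (P := []) (Q := []) ((encodeNat (f n)).map h.outputAlphabet.invFun)
  have r4 := dec2_run (eIn := h.inputAlphabet) (eOut := h.outputAlphabet) (g := fun _ => []) (W := W)
    (V := V) (N := []) (M := N) (U := List.replicate n false) (T := T) (D := []) (E := [])
    (P := (encodeNat (f n)).reverse) (Q := [])
  have e1 : List.map h.outputAlphabet ((encodeNat (f n)).map h.outputAlphabet.invFun) =
      encodeNat (f n) := by simp
  rw [e1] at r3
  rw [unaryEncodeNat_eq, List.map_replicate, List.length_replicate] at r2
  simp only [Function.update_eq_self, single, List.append_nil, hN, List.reverse_reverse,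
    List.length_map, List.length_reverse] at r1 r2 r3 r4
  exact (((r1.trans r2).trans r3).trans r4).mono (by omega)

/-- All bounds are turned into polynomials in the input length n², using n ≤ n². The machine rejects
if the length is not a square, if f(n) > n, or if the search is exhausted. -/
theorem decide_run (K : Polynomial ℕ) (hK : ∀ n, 2 ^ (n - f n) ≤ K.eval (n * n)) (w : List Bool) :
    ∃ ans, Runs h.inputAlphabet h.outputAlphabet (cfg .sq0 (start w))
      ⟨none, (h.tm.initialState, default), (start (tm := h.tm) [ans]).toFun⟩
      ((timeBound h K).eval w.length) ∧ (ans = true ↔ Accept f w) := by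
  suffices hs : ∃ ans s', Runs h.inputAlphabet h.outputAlphabet (cfg .sq0 (start w))
      (cfg (.clean ans) s') ((prepBound h).eval w.length + K.eval w.length *
        (w.length * (w.length + 4) + 6 * w.length + 9)) ∧ s'.g = (fun _ => []) ∧
      s'.size ≤ (sizeBound h).eval w.length ∧ (ans = true ↔ Accept f w) by
    obtain ⟨ans, s', r, hg, hs, ha⟩ := hs
    have := r.trans (clean_run ans s')
    rw [hg] at this
    refine ⟨ans, this.mono ?_, ha⟩
    simp [timeBound]
    omega
  have hsq := sq_run (eIn := h.inputAlphabet) (eOut := h.outputAlphabet) (g := fun _ => []) (W := w)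
    (V := []) (N := []) (U := []) (T := []) (D := []) (E := []) (P := []) (Q := []) rfl
  simp only [List.length_nil, zero_add, List.append_nil] at hsq
  rcases hsq with ⟨N, hN, r⟩ | ⟨hn, s', r, hg, hs⟩
  · generalize hn : N.length = n at hN
    have hnm : n ≤ w.length := by rw [← hN]; exact Nat.le_mul_self n
    have r1 := prep_run h n [] w.reverse [] N hn
    have hp := eval_le_eval (p := h.time) hnm
    have hb := eval_le_eval (p := outBound h) hnm
    have hL := length_encodeNat_le h n
    have ht : (n + 1) * (2 * (encodeNat (f n)).length + 1) ≤
        (w.length + 1) * (2 * (outBound h).eval w.length + 1) :=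
      Nat.mul_le_mul (by omega) (by omega)
    -- The `n` in `Accept` is determined by the length, so rejecting for this `n` is conclusive.
    have huniq {n' : ℕ} (hn' : n' * n' = w.length) : n' = n :=
      Nat.mul_self_inj.1 (hn'.trans hN.symm)
    by_cases hf : f n ≤ n
    · obtain ⟨P', hP, r2⟩ := dec_run (eIn := h.inputAlphabet) (eOut := h.outputAlphabet)
        (g := fun _ => []) (W := []) (V := w.reverse) (N := []) (M := N) (T := []) (D := [])
        (E := []) (Q := encodeNat (f n)) n (by rwa [bitsVal_encodeNat])
      rw [bitsVal_encodeNat] at r2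
      obtain ⟨ans, s', r3, hg, hs, ha⟩ := search_run (eIn := h.inputAlphabet)
        (eOut := h.outputAlphabet) (g := fun _ => []) (M := N) (P := P') (n := n) (k := n - f n)
        (w := w) (b := List.replicate (n - f n) false)
        (s := ⟨fun _ => [], [], w.reverse, [], N, List.replicate (n - f n) false, [], [], [], P',
          []⟩) ⟨rfl, rfl, rfl, rfl, rfl, by simp, rfl, by simp⟩ hN.symm hn (by simp)
      refine ⟨ans, s', (((r.trans r1).trans r2).trans r3).mono ?_, hg, ?_, ?_⟩
      · have ht' : (2 ^ (n - f n) - bitsVal (List.replicate (n - f n) false)) *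
            (n * n * (n + 4) + 3 * n + 9 + 3 * (n - f n)) ≤
            K.eval w.length * (w.length * (w.length + 4) + 6 * w.length + 9) := by
          refine Nat.mul_le_mul ((Nat.sub_le _ _).trans (hN ▸ hK n)) ?_
          have := Nat.mul_le_mul_left (n * n) (Nat.add_le_add_right hnm 4)
          rw [hN] at this ⊢
          omega
        simp [prepBound]
        omega
      · simp [sizeBound]
        omega
      · rw [ha, bitsVal_replicate_false]
        simp only [Nat.zero_le, true_and]
        refine ⟨fun hex => ⟨n, hN, hf, hex⟩, ?_⟩
        rintro ⟨n', hn', -, hex⟩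
        rwa [huniq hn'] at hex
    · obtain ⟨s', r2, hg, hs⟩ := dec_fail (eIn := h.inputAlphabet) (eOut := h.outputAlphabet)
        (g := fun _ => []) (W := []) (V := w.reverse) (N := []) (M := N) (T := []) (D := [])
        (E := []) (Q := encodeNat (f n)) n (by rw [bitsVal_encodeNat]; omega)
      refine ⟨false, s', ((r.trans r1).trans r2).mono ?_, hg, ?_, ?_⟩
      · simp [prepBound]
        omega
      · simp [sizeBound, Stacks.size] at hs ⊢
        omega
      · simp only [Bool.false_eq_true, false_iff]
        rintro ⟨n', hn', hf', -⟩
        rw [huniq hn'] at hf'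
        exact hf hf'
  · refine ⟨false, s', r.mono ?_, hg, hs.trans ?_, ?_⟩
    · simp [prepBound]
      omega
    · simp [Stacks.size, sizeBound]
      omega
    · simp only [Bool.false_eq_true, false_iff]
      rintro ⟨n, hn', -⟩
      exact hn n hn'

end

theorem initList_machine {tm : FinTM2} (eIn : tm.Γ tm.k₀ ≃ Bool) (eOut : tm.Γ tm.k₁ ≃ Bool)
    (w : List Bool) : initList (machine eIn eOut) w = cfg .sq0 (start w) := by
  refine congrArg (TM2.Cfg.mk _ _) (funext fun k => ?_)
  rcases k with k | (_ | _ | _ | _ | _ | _ | _ | _ | _ | _) <;> rfl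

theorem haltList_machine {tm : FinTM2} (eIn : tm.Γ tm.k₀ ≃ Bool) (eOut : tm.Γ tm.k₁ ≃ Bool)
    (w : List Bool) : haltList (machine eIn eOut) w =
      ⟨none, (tm.initialState, default), (start (tm := tm) w).toFun⟩ := by
  refine congrArg (TM2.Cfg.mk _ _) (funext fun k => ?_)
  rcases k with k | (_ | _ | _ | _ | _ | _ | _ | _ | _ | _) <;> rfl

/-- If `f` is computable in polynomial time and only polynomially many vertex sets have to be
searched, then the Ramsey quantifier is computable in polynomial time. -/
theorem polyTimeQuantifier_of_le {f : ℕ → ℕ} (hf : PolyTimeComputable f) (K : Polynomial ℕ)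
    (hK : ∀ n, 2 ^ (n - f n) ≤ K.eval (n * n)) : PolyTimeQuantifier (RamseyQuantifier f) := by
  classical
  obtain ⟨h⟩ := hf
  refine ⟨⟨⟨machine h.inputAlphabet h.outputAlphabet, Equiv.refl Bool, Equiv.refl Bool⟩,
    timeBound h K, fun w => ?_⟩⟩
  -- The certificate of a timed computation is data, so answer and number of steps are extracted by
  -- choice.
  have hrun := decide_run h K hK w
  have hans : hrun.choose = decide (w ∈ modelLanguage (RamseyQuantifier f)) := by
    rw [Bool.eq_iff_iff, hrun.choose_spec.2, decide_eq_true_iff, mem_modelLanguage_iff]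
  have hr := hrun.choose_spec.1
  rw [hans] at hr
  refine ⟨⟨hr.choose, ?_⟩, hr.choose_spec.1⟩
  refine Eq.trans (congrArg _ (congrArg some ?_)) (hr.choose_spec.2.trans (congrArg some ?_))
  · exact (congrArg (initList _) (List.map_id w)).trans (initList_machine _ _ w)
  · exact (haltList_machine _ _ _).symm

/-- Beyond a threshold `R`, exponentiating n - f(n) ≤ c log₂ n gives n^c, which is at most (n²)^c.
The constant 2^R takes care of all other n. -/
theorem two_pow_sub_le (c : ℕ) (f : ℕ → ℕ)
    (hlarge : ∀ᶠ n : ℕ in atTop, (n : ℝ) - (c : ℝ) * Real.logb 2 (n : ℝ) ≤ (f n : ℝ)) :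
    ∃ K : Polynomial ℕ, ∀ n, 2 ^ (n - f n) ≤ K.eval (n * n) := by
  obtain ⟨R, hR⟩ := eventually_atTop.1 hlarge
  refine ⟨.X ^ c + .C (2 ^ R), fun n => ?_⟩
  simp only [Polynomial.eval_add, Polynomial.eval_pow, Polynomial.eval_X, Polynomial.eval_C]
  by_cases hn : R ≤ n ∧ 0 < n ∧ f n ≤ n
  · obtain ⟨hRn, h0, hfn⟩ := hn
    have h1 : (2 : ℝ) ^ (n - f n) ≤ (n : ℝ) ^ c := by
      have hn' : (0 : ℝ) < n := by exact_mod_cast h0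
      have h2 : ((n - f n : ℕ) : ℝ) ≤ c * Real.logb 2 n := by
        rw [Nat.cast_sub hfn]
        linarith [hR n hRn]
      rw [← Real.rpow_natCast, ← Real.rpow_natCast]
      refine (Real.rpow_le_rpow_of_exponent_le (by norm_num) h2).trans_eq ?_
      rw [mul_comm, Real.rpow_mul (by norm_num), Real.rpow_logb (by norm_num) (by norm_num) hn']
    have h3 : 2 ^ (n - f n) ≤ n ^ c := by exact_mod_cast h1
    have h4 : n ^ c ≤ (n * n) ^ c := Nat.pow_le_pow_left (Nat.le_mul_self n) c
    exact le_add_right (h3.trans h4)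
  -- Either n < R, or the truncated difference is 0 because n = 0 or f(n) > n.
  · have : n - f n ≤ R := by omega
    have := Nat.pow_le_pow_right (show 0 < 2 by norm_num) this
    exact le_add_left this

end RamseyMachine

theorem mainTheorem6 (c : ℕ) (f : ℕ → ℕ) (hf : PolyTimeComputable f)
    (hlarge : ∀ᶠ n : ℕ in atTop, (n : ℝ) - (c : ℝ) * Real.logb 2 (n : ℝ) ≤ (f n : ℝ)) :
    PolyTimeQuantifier (RamseyQuantifier f) := by
  obtain ⟨K, hK⟩ := RamseyMachine.two_pow_sub_le c f hlarge
  exact RamseyMachine.polyTimeQuantifier_of_le hf K hK
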